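/- Let $G=(V,E)$ be a directed graph with $n$ vertices and $m\ge 1$ arcs (an undirected graph is the case in which every edge is present as two opposite arcs), with arc weights $w\ge 0$, and let $s\in V$ be a source from which every vertex is reachable. Write $d_{G,w}$ for the shortest-path distance. Call $d:V\to\mathbb R$ *$\alpha$-distance-preserving* for $(G,w,s)$, where $0\le\alpha\le1$, if $$\alpha\,d_{G,w}(s,u)\le d(u)\le d_{G,w}(s,u)\quad\text{and}\quad d(v)-d(u)\le d_{G,w}(u,v)\qquad\text{for all }u,v\in V .$$ For functions $d_0,d_1,\dots$ on $V$ let $w_i(e)=w(e)+\sum_{j<i}\bigl(d_j(u)-d_j(v)\bigr)$ for each arc $e$ from $u$ to $v$; these are the weights after $i$ rounds. There are numbers $R(\varepsilon)=O(1+\log\varepsilon^{-1})$, $0<\varepsilon<1$, depending only on $\varepsilon$, such that the following holds. 1. For all $G$, $s$ and real weights $w\ge0$ as above (here $m=0$ is allowed as well): if, for each $i<R(\varepsilon)$, $d_i$ is $(1/4)$-distance-preserving for $(G,w_i,s)$, then all weights $w_i(e)$ with $i\le R(\varepsilon)$ are nonnegative, and $\sum_{i<R(\varepsilon)}d_i$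 is $(1-\varepsilon)$-distance-preserving for $(G,w,s)$. 2. For every constant $k$ there are programs $P$ and $Q$ for a word RAM (unit-cost arithmetic, bitwise operations, shifts, comparisons and integer part of the binary logarithm, on words of $O(\log n')$ bits, where $n'=n+m$ for $P$ and $n'=n+m+\lceil\log_2\varepsilon^{-1}\rceil$ for $Q$; the graph is given by adjacency arrays), with constants depending only on $k$, such that: - for integer weights in $\{0,1,\dots,n^{k+1}\}$, $P$ computes integer $(1/4)$-distance-preserving distances $A(G,w,s)$ in time $O(m)$; - for integer weights in $\{0,1,\dots,n^{k}\}$ and every $0<\varepsilon<1$, $Q$, given $G,w,s$ and $\lceil\log_2\varepsilon^{-1}\rceil$, computes in total time $O\bigl(m(1+\log\varepsilon^{-1})\bigr)$ the sum $D=\sum_{i<R(\varepsilon)}d_i$ of the outputs $d_i=A(G,w_i,s)$ of the $R(\varepsilon)$ rounds. All reweighted weights $w_i$, $i\le R(\varepsilon)$, are integers in $\{0,\dots,n^{k+1}\}$, and $D$ is $(1-\varepsilon)$-distance-preserving for $(G,w,s)$; more generally, $\delta D$ is $(1-\varepsilon)$-distance-preserving for $(G,\delta w,s)$ for every real unit $\delta>0$.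 For $\varepsilon\le 1/2$ the number of rounds is thus $O(\log\varepsilon^{-1})$ and the total time $O(m\log\varepsilon^{-1})$. -/

import Mathlib

/-- A finite directed graph with vertex set `Fin n` and `m` arcs; arc `e` goes from `tail e` to
`head e`. An undirected graph is the case in which every edge is present as two opposite arcs. -/
structure ArcGraph (n m : ℕ) where
  tail : Fin m → Fin n
  head : Fin m → Fin n

namespace ArcGraph

variable {n m : ℕ}

/-- `G.IsWalk u p v`: the list of arcs `p` is a walk from `u` to `v`. -/
def IsWalk (G : ArcGraph n m) (u : Fin n) : List (Fin m) → Fin n → Prop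
  | [], v => u = v
  | e :: p, v => G.tail e = u ∧ G.IsWalk (G.head e) p v

/-- Every vertex can be reached from `s`, that is, all distances from `s` are finite. -/
def AllReachable (G : ArcGraph n m) (s : Fin n) : Prop :=
  ∀ v, ∃ p, G.IsWalk s p v

/-- The shortest-path distance from `u` to `v` for the arc weights `w`; it is `⊤` if there is no
walk from `u` to `v`. -/
noncomputable def dist (G : ArcGraph n m) (w : Fin m → ℝ) (u v : Fin n) : EReal :=
  ⨅ (p : List (Fin m)) (_ : G.IsWalk u p v), (((p.map w).sum : ℝ) : EReal)

/-- The single-source distances `d` from `s` are `α`-distance-preserving: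
`α d_G(s,u) ≤ d(u) ≤ d_G(s,u)` and `d(v) - d(u) ≤ d_G(u,v)`, with `0 ≤ α ≤ 1`. -/
def DistPreserving (G : ArcGraph n m) (w : Fin m → ℝ) (s : Fin n) (α : ℝ)
    (d : Fin n → ℝ) : Prop :=
  0 ≤ α ∧ α ≤ 1 ∧
    (∀ u, (α : EReal) * G.dist w s u ≤ (d u : EReal) ∧ (d u : EReal) ≤ G.dist w s u) ∧
    ∀ u v, ((d v - d u : ℝ) : EReal) ≤ G.dist w u v

/-- The weights after `i` rounds with outputs `d 0, …, d (i - 1)`: an arc from `u` to `v` of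
weight `w e` gets the weight `w e + ∑ j < i, (d j u - d j v)`. -/
noncomputable def reweight (G : ArcGraph n m) (w : Fin m → ℝ) (d : ℕ → Fin n → ℝ) (i : ℕ)
    (e : Fin m) : ℝ :=
  w e + ∑ j ∈ Finset.range i, (d j (G.tail e) - d j (G.head e))

end ArcGraph

/-! A word RAM, programmed by structured programs: finitely many registers used by the program, a
random-access memory, unit-cost word operations, and a bound on the words that may occur. -/

namespace RAM

/-- Contents of the registers and of the memory. -/
structure State where
  reg : ℕ → ℕ
  mem : ℕ → ℕ

inductive BinOp
  | add | sub | mul | div | mod | and | or | xor | shl | shr | lt | eq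

/-- Arithmetic on words; `sub` is truncated, comparisons return `1` or `0`. -/
def BinOp.eval : BinOp → ℕ → ℕ → ℕ
  | add, a, b => a + b
  | sub, a, b => a - b
  | mul, a, b => a * b
  | div, a, b => a / b
  | mod, a, b => a % b
  | and, a, b => a &&& b
  | or, a, b => a ||| b
  | xor, a, b => a ^^^ b
  | shl, a, b => a <<< b
  | shr, a, b => a >>> b
  | lt, a, b => if a < b then 1 else 0
  | eq, a, b => if a = b then 1 else 0

/-- Expressions: constants, registers, indirect reads from memory, the integer part of the binary
logarithm, and binary operations. -/
inductive Expr
  | lit (x : ℕ)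
  | reg (i : ℕ)
  | load (addr : Expr)
  | log2 (e : Expr)
  | bin (op : BinOp) (e₁ e₂ : Expr)

/-- A number is a word if it is at most `B`. -/
def word (B x : ℕ) : Option ℕ := if x ≤ B then some x else none

/-- The value of an expression; it is undefined if a number larger than `B` occurs. -/
def Expr.eval (B : ℕ) (σ : State) : Expr → Option ℕ
  | lit x => word B x
  | reg i => word B (σ.reg i)
  | load addr => (addr.eval B σ).bind fun a => word B (σ.mem a)
  | log2 e => (e.eval B σ).bind fun a => word B (Nat.log 2 a)
  | bin op e₁ e₂ =>
      (e₁.eval B σ).bind fun a => (e₂.eval B σ).bind fun b => word B (op.eval a b)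

/-- The number of unit-cost operations in an expression. -/
def Expr.cost : Expr → ℕ
  | lit _ => 1
  | reg _ => 1
  | load addr => addr.cost + 1
  | log2 e => e.cost + 1
  | bin _ e₁ e₂ => e₁.cost + e₂.cost + 1

inductive Prog
  | skip
  | assign (i : ℕ) (e : Expr)
  | store (addr e : Expr)
  | seq (p q : Prog)
  | ite (e : Expr) (p q : Prog)
  | loop (e : Expr) (p : Prog)

/-- `Exec B p σ t σ'`: started in `σ`, the program `p` halts after exactly `t` steps in `σ'`, and
no number larger than `B` occurs. A run in which such a number occurs does not halt properly. -/
inductive Exec (B : ℕ) : Prog → State → ℕ → State → Prop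
  | skip (σ : State) : Exec B .skip σ 1 σ
  | assign (σ : State) (i : ℕ) (e : Expr) (x : ℕ) (h : e.eval B σ = some x) :
      Exec B (.assign i e) σ (e.cost + 1) ⟨Function.update σ.reg i x, σ.mem⟩
  | store (σ : State) (addr e : Expr) (a x : ℕ) (ha : addr.eval B σ = some a)
      (h : e.eval B σ = some x) :
      Exec B (.store addr e) σ (addr.cost + e.cost + 1) ⟨σ.reg, Function.update σ.mem a x⟩
  | seq (p q : Prog) (σ σ' σ'' : State) (t t' : ℕ) (hp : Exec B p σ t σ')
      (hq : Exec B q σ' t' σ'') : Exec B (.seq p q) σ (t + t') σ''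
  | ite_true (e : Expr) (p q : Prog) (σ σ' : State) (x t : ℕ) (h : e.eval B σ = some x)
      (hx : x ≠ 0) (hp : Exec B p σ t σ') : Exec B (.ite e p q) σ (e.cost + 1 + t) σ'
  | ite_false (e : Expr) (p q : Prog) (σ σ' : State) (t : ℕ) (h : e.eval B σ = some 0)
      (hq : Exec B q σ t σ') : Exec B (.ite e p q) σ (e.cost + 1 + t) σ'
  | loop_true (e : Expr) (p : Prog) (σ σ' σ'' : State) (x t t' : ℕ) (h : e.eval B σ = some x)
      (hx : x ≠ 0) (hp : Exec B p σ t σ') (hl : Exec B (.loop e p) σ' t' σ'') :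
      Exec B (.loop e p) σ (e.cost + 1 + t + t') σ''
  | loop_false (e : Expr) (p : Prog) (σ : State) (h : e.eval B σ = some 0) :
      Exec B (.loop e p) σ (e.cost + 1) σ

/-- The start state: the input stands in memory from address `0` on, everything else is `0`. -/
def start (input : List ℕ) : State := ⟨fun _ => 0, fun a => input.getD a 0⟩

/-- On the given input, with words bounded by `B`, the program halts after at most `T` steps with
the values of `out` in consecutive memory cells, the address of the first being in register 0. -/
def Computes (p : Prog) (B : ℕ) (T : ℝ) (input : List ℕ) {n : ℕ} (out : Fin n → ℕ) : Prop :=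
  ∃ (t : ℕ) (σ : State), Exec B p (start input) t σ ∧ (t : ℝ) ≤ T ∧
    ∀ v : Fin n, σ.mem (σ.reg 0 + v) = out v

/-- The input `(G, w, s)` with a further number `b`, as adjacency arrays: `n`, `m`, `s`, `b`, then
for `v = 0, …, n` the number of arcs with tail `< v`, then the heads and then the weights of all
arcs. It describes `G` if the arcs are numbered in the order of their tails; then the arcs
leaving `v` are those from the `v`-th to just before the `(v+1)`-st of the `n + 1` offsets. -/
def encode {n m : ℕ} (G : ArcGraph n m) (w : Fin m → ℕ) (s : Fin n) (b : ℕ) : List ℕ :=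
  [n, m, (s : ℕ), b] ++
    (List.range (n + 1)).map
      (fun v => (Finset.univ.filter fun e : Fin m => (G.tail e : ℕ) < v).card) ++
    List.ofFn (fun e => (G.head e : ℕ)) ++ List.ofFn w

end RAM

/-! ### Rounded arc weights -/

/-- An arc of weight `w` is rounded to a multiple of `2 ^ level w`. -/
def level (w : ℕ) : ℕ := Nat.log 2 (w / 2)

/-- The number of multiples of `2 ^ level w` up to the time of arrival. -/
def stepKey (w y : ℕ) : ℕ := y / 2 ^ level w + 1 + min w 1

/-- The time of arrival over an arc of weight `w` that is entered at time `y`. -/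
def relax (w y : ℕ) : ℕ := stepKey w y * 2 ^ level w - 1

theorem two_pow_level_le {w M : ℕ} (hM : 1 ≤ M) (h : w ≤ M) : 2 ^ level w ≤ M := by
  unfold level
  rcases Nat.eq_zero_or_pos (w / 2) with h0 | h0
  · simpa [h0] using hM
  · exact (Nat.pow_log_le_self 2 h0.ne').trans (by omega)

theorem stepKey_pos (w y : ℕ) : 0 < stepKey w y :=
  Nat.add_pos_left (Nat.succ_pos _) _

theorem relax_add_one (w y : ℕ) : relax w y + 1 = stepKey w y * 2 ^ level w := by
  have := Nat.mul_pos (stepKey_pos w y) (Nat.two_pow_pos (level w))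
  unfold relax; omega

theorem relax_mono (w : ℕ) {y z : ℕ} (h : y ≤ z) : relax w y ≤ relax w z := by
  unfold relax stepKey
  gcongr

theorem relax_bounds (w y : ℕ) : 4 * y + w ≤ 4 * relax w y ∧ relax w y ≤ y + w := by
  have h1 := relax_add_one w y
  have h3 := Nat.div_add_mod y (2 ^ level w)
  have h4 := Nat.mod_lt y (Nat.two_pow_pos (level w))
  rcases Nat.lt_or_ge w 2 with hw | hw
  · have h0 : level w = 0 := by unfold level; rw [Nat.div_eq_of_lt hw]; simp
    have : relax w y = y + min w 1 := by unfold relax stepKey; rw [h0]; simp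
    omega
  · have h5 : 2 ^ level w ≤ w / 2 := Nat.pow_log_le_self 2 (by omega)
    have h6 : w / 2 < 2 ^ (level w + 1) := Nat.lt_pow_succ_log_self (by norm_num) _
    rw [pow_succ] at h6
    have h2 : stepKey w y * 2 ^ level w = 2 ^ level w * (y / 2 ^ level w) + 2 * 2 ^ level w := by
      unfold stepKey; rw [min_eq_right (by omega)]; ring
    omega

theorem le_relax (w y : ℕ) : y ≤ relax w y := by have := relax_bounds w y; omega

namespace ArcGraph

variable {n m : ℕ}

/-! ### Earliest arrival -/

/-- The time of arrival after the walk `p` started at time `y`. -/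
def walkTime (w : Fin m → ℕ) : ℕ → List (Fin m) → ℕ
  | y, [] => y
  | y, e :: p => walkTime w (relax (w e) y) p

theorem walkTime_mono (w : Fin m → ℕ) (p : List (Fin m)) {y z : ℕ} (h : y ≤ z) :
    walkTime w y p ≤ walkTime w z p := by
  induction p generalizing y z with
  | nil => exact h
  | cons e p ih => exact ih (relax_mono _ h)

theorem le_walkTime (w : Fin m → ℕ) (p : List (Fin m)) (y : ℕ) : y ≤ walkTime w y p := by
  induction p generalizing y with
  | nil => exact le_rfl
  | cons e p ih => exact (le_relax _ _).trans (ih _)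

theorem walkTime_concat (w : Fin m → ℕ) (p : List (Fin m)) (e : Fin m) (y : ℕ) :
    walkTime w y (p ++ [e]) = relax (w e) (walkTime w y p) := by
  induction p generalizing y with
  | nil => rfl
  | cons f p ih => exact ih _

theorem sum_le_walkTime (w : Fin m → ℕ) (p : List (Fin m)) (y : ℕ) :
    4 * y + (p.map w).sum ≤ 4 * walkTime w y p := by
  induction p generalizing y with
  | nil => simp [walkTime]
  | cons e p ih =>
    have := ih (relax (w e) y)
    have := relax_bounds (w e) y
    simp only [walkTime, List.map_cons, List.sum_cons]
    omega

theorem IsWalk.concat {G : ArcGraph n m} {u : Fin n} {p : List (Fin m)} {e : Fin m}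
    (h : G.IsWalk u p (G.tail e)) : G.IsWalk u (p ++ [e]) (G.head e) := by
  induction p generalizing u with
  | nil => exact ⟨h.symm, rfl⟩
  | cons f p ih => exact ⟨h.1, ih h.2⟩

/-- The earliest arrival at each vertex for the rounded weights. -/
noncomputable def arrival (G : ArcGraph n m) (w : Fin m → ℕ) (s v : Fin n) : ℕ :=
  sInf {t | ∃ p, G.IsWalk s p v ∧ walkTime w 0 p = t}

theorem arrival_le {G : ArcGraph n m} (w : Fin m → ℕ) {s v : Fin n} {p : List (Fin m)}
    (h : G.IsWalk s p v) : G.arrival w s v ≤ walkTime w 0 p :=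
  Nat.sInf_le ⟨p, h, rfl⟩

theorem exists_walkTime_eq_arrival {G : ArcGraph n m} (w : Fin m → ℕ) {s : Fin n}
    (hs : G.AllReachable s) (v : Fin n) : ∃ p, G.IsWalk s p v ∧ walkTime w 0 p = G.arrival w s v :=
  Nat.sInf_mem (s := {t | ∃ p, G.IsWalk s p v ∧ walkTime w 0 p = t})
    (let ⟨p, hp⟩ := hs v; ⟨_, p, hp, rfl⟩)

theorem arrival_self (G : ArcGraph n m) (w : Fin m → ℕ) (s : Fin n) : G.arrival w s s = 0 :=
  Nat.le_zero.1 (arrival_le (p := []) w rfl)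

theorem arrival_head_le {G : ArcGraph n m} (w : Fin m → ℕ) {s : Fin n}
    (hs : G.AllReachable s) (e : Fin m) :
    G.arrival w s (G.head e) ≤ relax (w e) (G.arrival w s (G.tail e)) := by
  obtain ⟨p, hp, h⟩ := exists_walkTime_eq_arrival w hs (G.tail e)
  rw [← h, ← walkTime_concat]
  exact arrival_le w hp.concat

/-- A function that increases by at most `M` along each arc is at most `n - 1` times `M`. -/
theorem le_mul_of_arcs {G : ArcGraph n m} {s : Fin n} (hs : G.AllReachable s) (f : Fin n → ℕ)
    (M : ℕ) (h0 : f s = 0) (h : ∀ e, f (G.head e) ≤ f (G.tail e) + M) (v : Fin n) :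
    f v ≤ (n - 1) * M := by
  by_contra! hv
  have hcross : ∀ t, t < n → ∃ x, t * M < f x + M ∧ f x ≤ t * M := by
    intro t ht
    rcases Nat.eq_zero_or_pos M with hM | hM
    · subst hM
      exfalso
      obtain ⟨p, hp⟩ := hs v
      have : ∀ p u, G.IsWalk u p v → f v ≤ f u := by
        intro p
        induction p with
        | nil => rintro u rfl; exact le_rfl
        | cons e p ih =>
          rintro u ⟨rfl, hp⟩
          exact (ih _ hp).trans (h e)
      have := this p s hp
      omega
    have hlt : t * M < f v := lt_of_le_of_lt (Nat.mul_le_mul_right M (by omega)) hv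
    obtain ⟨p, hp⟩ := hs v
    have key : ∀ p u, G.IsWalk u p v → f u ≤ t * M → ∃ x, t * M < f x + M ∧ f x ≤ t * M := by
      intro p
      induction p with
      | nil => rintro u rfl hu; omega
      | cons e p ih =>
        rintro u ⟨rfl, hp⟩ hu
        by_cases hx : t * M < f (G.tail e) + M
        · exact ⟨_, hx, hu⟩
        · exact ih _ hp ((h e).trans (by omega))
    exact key p s hp (by omega)
  have : Nonempty (Fin n) := ⟨s⟩
  choose! x hx using hcross
  have hM : 0 < M := by
    by_contra! hM
    have := hx 0 (by have := s.2; omega)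
    have h0 : M = 0 := by omega
    simp [h0] at this
    omega
  have hinj : Set.InjOn (fun t : ℕ => x t) (Finset.range n : Set ℕ) := by
    intro a ha b hb hab
    have ha := hx a (by simpa using ha)
    have hb := hx b (by simpa using hb)
    simp only at hab
    rw [← hab] at hb
    have h1 : a * M < (b + 1) * M := by linarith
    have h2 : b * M < (a + 1) * M := by linarith
    have := Nat.lt_of_mul_lt_mul_right h1
    have := Nat.lt_of_mul_lt_mul_right h2
    omega
  have hsurj : Finset.image x (Finset.range n) = Finset.univ := by
    apply Finset.eq_univ_of_card
    rw [Finset.card_image_of_injOn hinj]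
    simp
  have : v ∈ Finset.image x (Finset.range n) := hsurj ▸ Finset.mem_univ v
  obtain ⟨t, ht, rfl⟩ := Finset.mem_image.1 this
  have h1 := (hx t (by simpa using ht)).2
  have : t * M ≤ (n - 1) * M := Nat.mul_le_mul_right M (by simp at ht; omega)
  omega

/-! ### Distances -/

theorem le_dist_iff {G : ArcGraph n m} {w : Fin m → ℝ} {u v : Fin n} {x : ℝ} :
    (x : EReal) ≤ G.dist w u v ↔ ∀ p, G.IsWalk u p v → x ≤ (p.map w).sum := by
  simp [dist, le_iInf_iff]

theorem dist_le {G : ArcGraph n m} (w : Fin m → ℝ) {u v : Fin n} {p : List (Fin m)}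
    (h : G.IsWalk u p v) : G.dist w u v ≤ ((p.map w).sum : ℝ) :=
  iInf₂_le p h

theorem exists_coe_eq_dist {G : ArcGraph n m} {w : Fin m → ℝ} (hw : ∀ e, 0 ≤ w e) {s : Fin n}
    (hs : G.AllReachable s) (u : Fin n) : ∃ x : ℝ, 0 ≤ x ∧ G.dist w s u = x := by
  have h0 : ((0 : ℝ) : EReal) ≤ G.dist w s u := le_dist_iff.2 fun p _ =>
    List.sum_nonneg (by simp; intro e _; exact hw e)
  obtain ⟨p, hp⟩ := hs u
  have h1 := dist_le w hp
  lift G.dist w s u to ℝ using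
    ⟨fun h => by simp [h] at h1, fun h => by simp [h] at h0⟩ with x
  exact ⟨x, by simpa using h0, rfl⟩

theorem distPreserving_of_arcs {G : ArcGraph n m} {w : Fin m → ℝ} {s : Fin n} {α : ℝ}
    {d : Fin n → ℝ} (h0 : 0 ≤ α) (h1 : α ≤ 1) (hd : d s = 0)
    (h : ∀ e, d (G.head e) ≤ d (G.tail e) + w e)
    (hp : ∀ u, ∃ p, G.IsWalk s p u ∧ α * (p.map w).sum ≤ d u) : G.DistPreserving w s α d := by
  have key : ∀ v p u, G.IsWalk u p v → d v - d u ≤ (p.map w).sum := by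
    intro v p
    induction p with
    | nil => rintro u rfl; simp
    | cons e p ih =>
      rintro u ⟨rfl, hp⟩
      have := ih _ hp
      have := h e
      simp only [List.map_cons, List.sum_cons]
      linarith
  refine ⟨h0, h1, fun u => ⟨?_, ?_⟩, fun u v => le_dist_iff.2 fun p hp => key v p u hp⟩
  · obtain ⟨p, hp, hle⟩ := hp u
    calc (α : EReal) * G.dist w s u ≤ α * ((p.map w).sum : ℝ) :=
          mul_le_mul_of_nonneg_left (dist_le w hp) (by exact_mod_cast h0)
      _ ≤ d u := by exact_mod_cast hle
  · refine le_dist_iff.2 fun p hp => ?_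
    have := key u p s hp
    linarith

theorem sum_map_reweight (G : ArcGraph n m) (w : Fin m → ℝ) (d : ℕ → Fin n → ℝ) (i : ℕ)
    {v : Fin n} (p : List (Fin m)) (u : Fin n) (hp : G.IsWalk u p v) :
    (p.map (G.reweight w d i)).sum =
      (p.map w).sum + ∑ j ∈ Finset.range i, d j u - ∑ j ∈ Finset.range i, d j v := by
  induction p generalizing u with
  | nil => cases hp; simp
  | cons e p ih =>
    obtain ⟨rfl, hp⟩ := hp
    simp only [List.map_cons, List.sum_cons, ih _ hp, reweight, Finset.sum_sub_distrib]
    ring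

theorem DistPreserving.le_arc {G : ArcGraph n m} {w : Fin m → ℝ} {s : Fin n} {α : ℝ}
    {d : Fin n → ℝ} (h : G.DistPreserving w s α d) (e : Fin m) :
    d (G.head e) - d (G.tail e) ≤ w e := by
  simpa using le_dist_iff.1 (h.2.2.2 (G.tail e) (G.head e)) [e] ⟨rfl, rfl⟩

theorem reweight_succ (G : ArcGraph n m) (w : Fin m → ℝ) (d : ℕ → Fin n → ℝ) (i : ℕ) (e : Fin m) :
    G.reweight w d (i + 1) e = G.reweight w d i e + (d i (G.tail e) - d i (G.head e)) := by
  simp only [reweight, Finset.sum_range_succ]; ring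

theorem reweight_nonneg {G : ArcGraph n m} {w : Fin m → ℝ} {s : Fin n} {α : ℝ}
    {d : ℕ → Fin n → ℝ} {R : ℕ} (hw : ∀ e, 0 ≤ w e)
    (h : ∀ i < R, G.DistPreserving (G.reweight w d i) s α (d i)) :
    ∀ i ≤ R, ∀ e, 0 ≤ G.reweight w d i e := by
  intro i hi e
  cases i with
  | zero => simpa [reweight] using hw e
  | succ i =>
    have := (h i hi).le_arc e
    rw [reweight_succ]
    linarith

/-- Repeated rounds with reweighting: the relative error decreases geometrically. -/
theorem distPreserving_sum {G : ArcGraph n m} {w : Fin m → ℝ} {s : Fin n} {α : ℝ}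
    {d : ℕ → Fin n → ℝ} {R : ℕ} (hα : 0 ≤ α) (hα1 : α ≤ 1) (hw : ∀ e, 0 ≤ w e)
    (hs : G.AllReachable s)
    (h : ∀ i < R, G.DistPreserving (G.reweight w d i) s α (d i)) {β : ℝ} (hβ : 0 ≤ β)
    (hβ1 : β ≤ 1 - (1 - α) ^ R) :
    G.DistPreserving w s β (fun v => ∑ i ∈ Finset.range R, d i v) := by
  have hnn := reweight_nonneg hw h
  have hd0 : ∀ i < R, d i s = 0 := by
    intro i hi
    have h1 : d i s ≤ 0 := by simpa using le_dist_iff.1 ((h i hi).2.2.1 s).2 [] rfl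
    obtain ⟨x, hx, hxd⟩ := exists_coe_eq_dist (hnn i hi.le) hs s
    have h2 := ((h i hi).2.2.1 s).1
    rw [hxd] at h2
    have h2 : α * x ≤ d i s := by exact_mod_cast h2
    nlinarith [mul_nonneg hα hx]
  have hD0 : ∀ i ≤ R, ∑ j ∈ Finset.range i, d j s = 0 := fun i hi =>
    Finset.sum_eq_zero fun j hj => hd0 j (by have := Finset.mem_range.1 hj; omega)
  choose ρ hρ0 hρ using exists_coe_eq_dist hw hs
  have hdist : ∀ i ≤ R, ∀ u, G.dist (G.reweight w d i) s u =
      ((ρ u - ∑ j ∈ Finset.range i, d j u : ℝ) : EReal) := by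
    intro i hi u
    obtain ⟨x, hx, hxd⟩ := exists_coe_eq_dist (hnn i hi) hs u
    have key : ∀ z : ℝ, z ≤ x ↔ z + ∑ j ∈ Finset.range i, d j u ≤ ρ u := by
      intro z
      rw [← EReal.coe_le_coe_iff, ← hxd, le_dist_iff, ← EReal.coe_le_coe_iff, ← hρ, le_dist_iff]
      refine forall₂_congr fun p hp => ?_
      rw [sum_map_reweight G w d i p s hp, hD0 i hi]
      constructor <;> intro h <;> linarith
    have h1 := (key x).1 le_rfl
    have h2 := (key (ρ u - ∑ j ∈ Finset.range i, d j u)).2 (by linarith)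
    rw [hxd, EReal.coe_eq_coe_iff]
    linarith
  have hup : ∀ i ≤ R, ∀ u, ∑ j ∈ Finset.range i, d j u ≤ ρ u := by
    intro i hi u
    have : ((0 : ℝ) : EReal) ≤ G.dist (G.reweight w d i) s u := le_dist_iff.2 fun p _ =>
      List.sum_nonneg (by simp; intro e _; exact hnn i hi e)
    rw [hdist i hi, EReal.coe_le_coe_iff] at this
    linarith
  have hlow : ∀ i ≤ R, ∀ u, ρ u - ∑ j ∈ Finset.range i, d j u ≤ (1 - α) ^ i * ρ u := by
    intro i
    induction i with
    | zero => simp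
    | succ i ih =>
      intro hi u
      have h1 := ih (by omega) u
      have h2 := ((h i hi).2.2.1 u).1
      rw [hdist i (by omega), ← EReal.coe_mul, EReal.coe_le_coe_iff] at h2
      rw [Finset.sum_range_succ, pow_succ]
      nlinarith
  have hpow : 0 ≤ (1 - α) ^ R := pow_nonneg (by linarith) R
  refine ⟨hβ, by linarith, fun u => ⟨?_, ?_⟩, fun u v => le_dist_iff.2 fun p hp => ?_⟩
  · rw [hρ, ← EReal.coe_mul, EReal.coe_le_coe_iff]
    have := hlow R le_rfl u
    nlinarith [hρ0 u]
  · rw [hρ, EReal.coe_le_coe_iff]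
    exact hup R le_rfl u
  · have h1 := sum_map_reweight G w d R p u hp
    have h2 : 0 ≤ (p.map (G.reweight w d R)).sum :=
      List.sum_nonneg (by simp; intro e _; exact hnn R le_rfl e)
    simp only
    linarith

/-- The earliest arrival is `1/4`-distance-preserving, for every unit `δ`. -/
theorem distPreserving_arrival {G : ArcGraph n m} (w : Fin m → ℕ) {s : Fin n}
    (hs : G.AllReachable s) {δ : ℝ} (hδ : 0 ≤ δ) :
    G.DistPreserving (fun e => δ * (w e : ℝ)) s (1 / 4) (fun v => δ * (G.arrival w s v : ℝ)) := by
  refine distPreserving_of_arcs (by norm_num) (by norm_num) (by simp [arrival_self]) ?_ ?_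
  · intro e
    have h : G.arrival w s (G.head e) ≤ G.arrival w s (G.tail e) + w e :=
      (arrival_head_le w hs e).trans (relax_bounds _ _).2
    have h : (G.arrival w s (G.head e) : ℝ) ≤ G.arrival w s (G.tail e) + w e := by exact_mod_cast h
    nlinarith
  · intro u
    obtain ⟨p, hp, h⟩ := exists_walkTime_eq_arrival w hs u
    refine ⟨p, hp, ?_⟩
    have h1 := sum_le_walkTime w p 0
    rw [h] at h1
    have h2 : (((p.map w).sum : ℕ) : ℝ) ≤ 4 * G.arrival w s u := by exact_mod_cast (by omega)
    have h3 : (p.map fun e => δ * (w e : ℝ)).sum = δ * (((p.map w).sum : ℕ) : ℝ) := by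
      rw [List.sum_map_mul_left]
      simp [Nat.cast_list_sum, Function.comp_def]
    rw [h3]
    nlinarith

/-! ### Integer rounds -/

/-- The weights after `i` rounds of `arrival`. -/
noncomputable def roundWeight (G : ArcGraph n m) (w : Fin m → ℕ) (s : Fin n) : ℕ → Fin m → ℕ
  | 0 => w
  | i + 1 => fun e => roundWeight G w s i e + G.arrival (roundWeight G w s i) s (G.tail e) -
      G.arrival (roundWeight G w s i) s (G.head e)

/-- The sum of the outputs of the first `i` rounds of `arrival`. -/
noncomputable def roundSum (G : ArcGraph n m) (w : Fin m → ℕ) (s : Fin n) (i : ℕ) (v : Fin n) : ℕ :=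
  ∑ j ∈ Finset.range i, G.arrival (G.roundWeight w s j) s v

theorem roundSum_succ (G : ArcGraph n m) (w : Fin m → ℕ) (s : Fin n) (i : ℕ) (v : Fin n) :
    G.roundSum w s (i + 1) v = G.roundSum w s i v + G.arrival (G.roundWeight w s i) s v :=
  Finset.sum_range_succ _ _

theorem roundWeight_add {G : ArcGraph n m} (w : Fin m → ℕ) {s : Fin n} (hs : G.AllReachable s)
    (i : ℕ) (e : Fin m) : G.roundWeight w s i e + G.roundSum w s i (G.head e) =
      w e + G.roundSum w s i (G.tail e) := by
  induction i with
  | zero => rfl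
  | succ i ih =>
    have h := (arrival_head_le (G.roundWeight w s i) hs e).trans (relax_bounds _ _).2
    simp only [roundSum_succ, roundWeight]
    omega

theorem roundSum_self (G : ArcGraph n m) (w : Fin m → ℕ) (s : Fin n) (i : ℕ) :
    G.roundSum w s i s = 0 :=
  Finset.sum_eq_zero fun _ _ => arrival_self _ _ _

theorem roundSum_le {G : ArcGraph n m} {w : Fin m → ℕ} {s : Fin n} (hs : G.AllReachable s)
    {M : ℕ} (hw : ∀ e, w e ≤ M) (i : ℕ) (v : Fin n) : G.roundSum w s i v ≤ (n - 1) * M := by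
  refine le_mul_of_arcs hs _ M (roundSum_self G w s i) (fun e => ?_) v
  have := roundWeight_add w hs i e
  have := hw e
  omega

theorem roundWeight_le {G : ArcGraph n m} {w : Fin m → ℕ} {s : Fin n} (hs : G.AllReachable s)
    {M : ℕ} (hw : ∀ e, w e ≤ M) (i : ℕ) (e : Fin m) : G.roundWeight w s i e ≤ n * M := by
  have h1 := roundWeight_add w hs i e
  have h2 := hw e
  have h3 := roundSum_le hs hw i (G.tail e)
  have h4 : n * M = (n - 1) * M + M := by
    obtain ⟨k, rfl⟩ : ∃ k, n = k + 1 := ⟨n - 1, by have := s.2; omega⟩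
    simp; ring
  omega

theorem arrival_bound {G : ArcGraph n m} {w : Fin m → ℕ} {s : Fin n} (hs : G.AllReachable s)
    {M : ℕ} (hw : ∀ e, w e ≤ M) (v : Fin n) : G.arrival w s v ≤ (n - 1) * M := by
  refine le_mul_of_arcs hs _ M (arrival_self G w s) (fun e => ?_) v
  have := (arrival_head_le w hs e).trans (relax_bounds _ _).2
  have := hw e
  omega

theorem cast_roundWeight {G : ArcGraph n m} (w : Fin m → ℕ) {s : Fin n} (hs : G.AllReachable s)
    (δ : ℝ) (i : ℕ) (e : Fin m) : G.reweight (fun e => δ * (w e : ℝ))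
      (fun j v => δ * (G.arrival (G.roundWeight w s j) s v : ℝ)) i e =
      δ * (G.roundWeight w s i e : ℝ) := by
  have h := roundWeight_add w hs i e
  have h : (G.roundWeight w s i e : ℝ) + G.roundSum w s i (G.head e) =
      w e + G.roundSum w s i (G.tail e) := by exact_mod_cast h
  simp only [roundSum, Nat.cast_sum] at h
  rw [reweight, Finset.sum_sub_distrib, ← Finset.mul_sum, ← Finset.mul_sum]
  linear_combination (-δ) * h

end ArcGraph

/-! ### Lowest set bits and the next event -/

theorem exists_lowest_bit (x : ℕ) (hx : x ≠ 0) : ∃ i, x ^^^ (x &&& (x - 1)) = 2 ^ i ∧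
    x.testBit i = true ∧ ∀ j, x.testBit j = true → i ≤ j := by
  induction x using Nat.strong_induction_on with
  | _ x ih =>
    rcases Nat.even_or_odd' x with ⟨t, rfl | rfl⟩
    · obtain ⟨i, h1, h2, h3⟩ := ih t (by omega) (by omega)
      refine ⟨i + 1, ?_, ?_, ?_⟩
      · apply Nat.eq_of_testBit_eq
        intro j
        cases j with
        | zero =>
          have f1 : (2 * t).testBit 0 = false := by simp [Nat.testBit_zero]
          simp only [Nat.testBit_xor, Nat.testBit_and, Nat.testBit_two_pow, f1]
          simp
        | succ j =>
          have h4 : (2 * t - 1) / 2 = t - 1 := by omega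
          have f1 : (2 * t).testBit (j + 1) = t.testBit j := by
            rw [Nat.testBit_succ, Nat.mul_div_cancel_left t two_pos]
          have f2 : (2 * t - 1).testBit (j + 1) = (t - 1).testBit j := by rw [Nat.testBit_succ, h4]
          have h5 := congrArg (fun z => Nat.testBit z j) h1
          simp only [Nat.testBit_xor, Nat.testBit_and, Nat.testBit_two_pow, f1, f2] at h5 ⊢
          rw [h5]
          simp
      · simpa [Nat.testBit_succ] using h2
      · intro j hj
        cases j with
        | zero => simp [Nat.testBit_zero] at hj
        | succ j => have := h3 j (by simpa [Nat.testBit_succ] using hj); omega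
    · refine ⟨0, ?_, by simp [Nat.testBit_zero], fun j _ => by omega⟩
      apply Nat.eq_of_testBit_eq
      intro j
      have h4 : (2 * t + 1) / 2 = t := by omega
      cases j with
      | zero =>
        have f1 : (2 * t + 1).testBit 0 = true := by simp [Nat.testBit_zero]
        have f2 : (2 * t).testBit 0 = false := by simp [Nat.testBit_zero]
        simp only [Nat.testBit_xor, Nat.testBit_and, Nat.add_sub_cancel, f1, f2]
        simp
      | succ j =>
        have f1 : (2 * t + 1).testBit (j + 1) = t.testBit j := by rw [Nat.testBit_succ, h4]
        have f2 : (2 * t).testBit (j + 1) = t.testBit j := by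
          rw [Nat.testBit_succ, Nat.mul_div_cancel_left t two_pos]
        simp only [Nat.testBit_xor, Nat.testBit_and, Nat.add_sub_cancel, f1, f2]
        simp [Nat.testBit_succ]

theorem log_lowest_bit {x : ℕ} (hx : x ≠ 0) :
    x.testBit (Nat.log 2 (x ^^^ (x &&& (x - 1)))) = true ∧
    ∀ j, x.testBit j = true → Nat.log 2 (x ^^^ (x &&& (x - 1))) ≤ j := by
  obtain ⟨i, h1, h2, h3⟩ := exists_lowest_bit x hx
  rw [h1, Nat.log_pow (by norm_num)]
  exact ⟨h2, h3⟩

/-- Bit `j` of the mask for the parity of `q`. -/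
def bucketBit (E₀ E₁ q j : ℕ) : Bool := if q % 2 = 0 then E₀.testBit j else E₁.testBit j

theorem bucketBit_next (E₀ E₁ y j : ℕ) :
    ((E₀ &&& y) ||| (E₁ ^^^ (E₁ &&& y))).testBit j = bucketBit E₀ E₁ (y / 2 ^ j + 1) j := by
  have h : y.testBit j = decide (y / 2 ^ j % 2 = 1) := Nat.testBit_eq_decide_div_mod_eq
  rcases Nat.mod_two_eq_zero_or_one (y / 2 ^ j) with h0 | h0
  · have h1 : (y / 2 ^ j + 1) % 2 = 1 := by omega
    simp [bucketBit, h1, h, h0]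
  · have h1 : (y / 2 ^ j + 1) % 2 = 0 := by omega
    simp [bucketBit, h1, h, h0]

theorem bucketBit_second (E₀ E₁ y j : ℕ) :
    ((E₁ &&& y) ||| (E₀ ^^^ (E₀ &&& y))).testBit j = bucketBit E₀ E₁ (y / 2 ^ j + 2) j := by
  have h : y.testBit j = decide (y / 2 ^ j % 2 = 1) := Nat.testBit_eq_decide_div_mod_eq
  rcases Nat.mod_two_eq_zero_or_one (y / 2 ^ j) with h0 | h0
  · simp [bucketBit, h, h0]
  · simp [bucketBit, h, h0]

theorem add_mul_two_pow_mono (y : ℕ) {i j c : ℕ} (hij : i ≤ j) (hc : 1 ≤ c) :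
    (y / 2 ^ i + c) * 2 ^ i ≤ (y / 2 ^ j + c) * 2 ^ j := by
  obtain ⟨t, rfl⟩ := Nat.exists_eq_add_of_le hij
  have h1 : y / 2 ^ i < (y / 2 ^ (i + t) + 1) * 2 ^ t := by
    rw [Nat.div_lt_iff_lt_mul (Nat.two_pow_pos i), mul_assoc, ← pow_add, add_comm t i]
    have h2 := Nat.div_add_mod y (2 ^ (i + t))
    have h3 := Nat.mod_lt y (Nat.two_pow_pos (i + t))
    rw [add_mul, mul_comm]
    omega
  have h2 : y / 2 ^ i + c ≤ (y / 2 ^ (i + t) + c) * 2 ^ t := by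
    obtain ⟨d, rfl⟩ := Nat.exists_eq_add_of_le hc
    have := Nat.le_mul_of_pos_right d (Nat.two_pow_pos t)
    calc y / 2 ^ i + (1 + d) ≤ (y / 2 ^ (i + t) + 1) * 2 ^ t + d * 2 ^ t := by omega
      _ = _ := by ring
  calc (y / 2 ^ i + c) * 2 ^ i ≤ (y / 2 ^ (i + t) + c) * 2 ^ t * 2 ^ i := Nat.mul_le_mul_right _ h2
    _ = _ := by rw [pow_add]; ring

/-- The bucket of level `i` and key `q` is nonempty, and no live bucket has a smaller time. -/
def IsNext (E₀ E₁ y i q : ℕ) : Prop :=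
  bucketBit E₀ E₁ q i = true ∧ (q = y / 2 ^ i + 1 ∨ q = y / 2 ^ i + 2) ∧
  ∀ j r, bucketBit E₀ E₁ r j = true → r = y / 2 ^ j + 1 ∨ r = y / 2 ^ j + 2 →
    q * 2 ^ i ≤ r * 2 ^ j

theorem isNext_select {E₀ E₁ y N S a b : ℕ} (hE : E₀ ||| E₁ ≠ 0)
    (hN : N = (E₀ &&& y) ||| (E₁ ^^^ (E₁ &&& y))) (hS : S = (E₁ &&& y) ||| (E₀ ^^^ (E₀ &&& y)))
    (ha : a = Nat.log 2 (N ^^^ (N &&& (N - 1)))) (hb : b = Nat.log 2 (S ^^^ (S &&& (S - 1)))) :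
    ((N = 0 ∨ S ≠ 0 ∧ (y / 2 ^ b + 2) * 2 ^ b < (y / 2 ^ a + 1) * 2 ^ a) →
      IsNext E₀ E₁ y b (y / 2 ^ b + 2)) ∧
    (¬ (N = 0 ∨ S ≠ 0 ∧ (y / 2 ^ b + 2) * 2 ^ b < (y / 2 ^ a + 1) * 2 ^ a) →
      IsNext E₀ E₁ y a (y / 2 ^ a + 1)) := by
  have tN : ∀ j, N.testBit j = bucketBit E₀ E₁ (y / 2 ^ j + 1) j := hN ▸ bucketBit_next E₀ E₁ y
  have tS : ∀ j, S.testBit j = bucketBit E₀ E₁ (y / 2 ^ j + 2) j := hS ▸ bucketBit_second E₀ E₁ y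
  have hNS : N = 0 → S ≠ 0 := by
    rintro rfl rfl
    apply hE
    apply Nat.eq_of_testBit_eq
    intro j
    have h1 := tN j
    have h2 := tS j
    simp only [bucketBit, Nat.zero_testBit] at h1 h2
    simp only [Nat.testBit_or, Nat.zero_testBit]
    rcases Nat.mod_two_eq_zero_or_one (y / 2 ^ j) with h0 | h0
    · rw [if_neg (by omega)] at h1
      rw [if_pos (by omega)] at h2
      simp [← h1, ← h2]
    · rw [if_pos (by omega)] at h1
      rw [if_neg (by omega)] at h2
      simp [← h1, ← h2]
  constructor
  · intro h
    have hS0 : S ≠ 0 := h.elim hNS (·.1)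
    obtain ⟨l1, l2⟩ := hb ▸ log_lowest_bit hS0
    refine ⟨(tS b).symm.trans l1, Or.inr rfl, ?_⟩
    rintro j r hr (rfl | rfl)
    · rw [← tN] at hr
      rcases h with h | h
      · simp [h] at hr
      · have hN0 : N ≠ 0 := by rintro h0; simp [h0] at hr
        have := (ha ▸ log_lowest_bit hN0).2 j hr
        exact h.2.le.trans (add_mul_two_pow_mono y this le_rfl)
    · rw [← tS] at hr
      exact add_mul_two_pow_mono y (l2 j hr) (by norm_num)
  · intro h
    have hN0 : N ≠ 0 := by tauto
    obtain ⟨l1, l2⟩ := ha ▸ log_lowest_bit hN0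
    refine ⟨(tN a).symm.trans l1, Or.inl rfl, ?_⟩
    rintro j r hr (rfl | rfl)
    · rw [← tN] at hr
      exact add_mul_two_pow_mono y (l2 j hr) le_rfl
    · rw [← tS] at hr
      have hS0 : S ≠ 0 := by rintro h0; simp [h0] at hr
      have h1 := (hb ▸ log_lowest_bit hS0).2 j hr
      have h2 : ¬ (y / 2 ^ b + 2) * 2 ^ b < (y / 2 ^ a + 1) * 2 ^ a := by tauto
      exact (not_lt.1 h2).trans (add_mul_two_pow_mono y h1 (by norm_num))

/-! ### Buckets as linked lists -/

section Buckets

variable {m : ℕ}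

/-- The list starting at the link `x` is `l`; the link to `e` is `e + 1`, the end is `0`. -/
def IsLinked (nxt : Fin m → ℕ) : ℕ → List (Fin m) → Prop
  | x, [] => x = 0
  | x, e :: l => x = e + 1 ∧ IsLinked nxt (nxt e) l

theorem IsLinked.update {nxt : Fin m → ℕ} {e : Fin m} (z : ℕ) {l : List (Fin m)} (he : e ∉ l)
    {x : ℕ} (h : IsLinked nxt x l) : IsLinked (Function.update nxt e z) x l := by
  induction l generalizing x with
  | nil => exact h
  | cons f l ih =>
    have hf : f ≠ e := by rintro rfl; simp at he
    refine ⟨h.1, ?_⟩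
    rw [Function.update_of_ne hf]
    exact ih (by simp at he; tauto) h.2

/-- The elements of `Q` are stored, each `e` in the list of its bucket `slot e`. -/
def IsQueue (slot : Fin m → ℕ) (Q : Finset (Fin m)) (nxt : Fin m → ℕ) (bh : ℕ → ℕ) : Prop :=
  ∃ L : ℕ → List (Fin m), ∀ i, IsLinked nxt (bh i) (L i) ∧ (L i).Nodup ∧
    ∀ e, e ∈ L i ↔ e ∈ Q ∧ slot e = i

theorem IsQueue.push {slot : Fin m → ℕ} {Q : Finset (Fin m)} {nxt : Fin m → ℕ} {bh : ℕ → ℕ}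
    (h : IsQueue slot Q nxt bh) {e : Fin m} (he : e ∉ Q) :
    IsQueue slot (insert e Q) (Function.update nxt e (bh (slot e)))
      (Function.update bh (slot e) (e + 1)) := by
  obtain ⟨L, hL⟩ := h
  have hn : ∀ i, e ∉ L i := fun i hi => he (((hL i).2.2 e).1 hi).1
  refine ⟨Function.update L (slot e) (e :: L (slot e)), fun i => ?_⟩
  by_cases hi : i = slot e
  · subst hi
    simp only [Function.update_self]
    refine ⟨⟨rfl, ?_⟩, List.nodup_cons.2 ⟨hn _, (hL _).2.1⟩, fun f => ?_⟩
    · rw [Function.update_self]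
      exact (hL _).1.update _ (hn _)
    · rw [List.mem_cons, Finset.mem_insert, (hL _).2.2]
      constructor
      · rintro (rfl | h)
        · exact ⟨Or.inl rfl, rfl⟩
        · exact ⟨Or.inr h.1, h.2⟩
      · tauto
  · rw [Function.update_of_ne hi, Function.update_of_ne hi]
    refine ⟨(hL _).1.update _ (hn _), (hL _).2.1, fun f => ?_⟩
    rw [Finset.mem_insert, (hL _).2.2]
    constructor
    · tauto
    · rintro ⟨rfl | h, h1⟩
      · exact absurd h1.symm hi
      · exact ⟨h, h1⟩

theorem IsQueue.pop {slot : Fin m → ℕ} {Q : Finset (Fin m)} {nxt : Fin m → ℕ} {bh : ℕ → ℕ}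
    (h : IsQueue slot Q nxt bh) {i : ℕ} (hi : bh i ≠ 0) :
    ∃ e ∈ Q, slot e = i ∧ bh i = e + 1 ∧
      IsQueue slot (Q.erase e) nxt (Function.update bh i (nxt e)) := by
  obtain ⟨L, hL⟩ := h
  obtain ⟨h1, h2, h3⟩ := hL i
  match hl : L i with
  | [] => rw [hl] at h1; exact absurd h1 hi
  | e :: l =>
    rw [hl] at h1 h2 h3
    obtain ⟨heQ, hei⟩ := (h3 e).1 (by simp)
    rw [List.nodup_cons] at h2
    refine ⟨e, heQ, hei, h1.1, Function.update L i l, fun j => ?_⟩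
    by_cases hj : j = i
    · subst hj
      simp only [Function.update_self]
      refine ⟨h1.2, h2.2, fun f => ?_⟩
      have := h3 f
      rw [List.mem_cons] at this
      rw [Finset.mem_erase, and_assoc, ← this]
      constructor
      · intro hf; exact ⟨by rintro rfl; exact h2.1 hf, Or.inr hf⟩
      · tauto
    · rw [Function.update_of_ne hj, Function.update_of_ne hj]
      refine ⟨(hL j).1, (hL j).2.1, fun f => ?_⟩
      rw [(hL j).2.2, Finset.mem_erase]
      constructor
      · rintro ⟨h4, h5⟩; exact ⟨⟨by rintro rfl; exact hj (h5.symm.trans hei), h4⟩, h5⟩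
      · tauto

theorem IsQueue.bh_ne_zero {slot : Fin m → ℕ} {Q : Finset (Fin m)} {nxt : Fin m → ℕ}
    {bh : ℕ → ℕ} (h : IsQueue slot Q nxt bh) {e : Fin m} (he : e ∈ Q) : bh (slot e) ≠ 0 := by
  obtain ⟨L, hL⟩ := h
  obtain ⟨h1, h2, h3⟩ := hL (slot e)
  have := (h3 e).2 ⟨he, rfl⟩
  match hl : L (slot e) with
  | [] => simp [hl] at this
  | f :: l => rw [hl] at h1; rw [h1.1]; omega

theorem isQueue_empty (slot : Fin m → ℕ) (nxt : Fin m → ℕ) {bh : ℕ → ℕ} (h : ∀ i, bh i = 0) :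
    IsQueue slot ∅ nxt bh :=
  ⟨fun _ => [], fun i => ⟨h i, by simp, by simp⟩⟩

theorem IsQueue.eq_zero {slot : Fin m → ℕ} {nxt : Fin m → ℕ} {bh : ℕ → ℕ}
    (h : IsQueue slot ∅ nxt bh) (i : ℕ) : bh i = 0 := by
  by_contra hi
  obtain ⟨e, he, _⟩ := h.pop hi
  simp at he

/-- The masks hold the nonempty buckets; bucket `2 * j + p` has level `j` and parity `p`. -/
def IsMask (bh : ℕ → ℕ) (E₀ E₁ : ℕ) : Prop :=
  ∀ q j, bucketBit E₀ E₁ q j = true ↔ bh (2 * j + q % 2) ≠ 0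

theorem testBit_shiftLeft_bit (b j i : ℕ) (hb : b ≤ 1) :
    (b <<< j).testBit i = decide (b = 1 ∧ i = j) := by
  have : b = 0 ∨ b = 1 := by omega
  rcases this with rfl | rfl
  · simp
  · simp [Nat.one_shiftLeft, Nat.testBit_two_pow, eq_comm]

theorem IsMask.push {bh : ℕ → ℕ} {E₀ E₁ : ℕ} (h : IsMask bh E₀ E₁) (q j : ℕ) {x : ℕ}
    (hx : x ≠ 0) : IsMask (Function.update bh (2 * j + q % 2) x)
      (E₀ ||| ((1 - q % 2) <<< j)) (E₁ ||| ((q % 2) <<< j)) := by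
  intro r i
  have := h r i
  simp only [bucketBit, Nat.testBit_or, Function.update_apply] at this ⊢
  rw [testBit_shiftLeft_bit _ _ _ (by omega), testBit_shiftLeft_bit _ _ _ (by omega)]
  by_cases hij : i = j ∧ r % 2 = q % 2
  · obtain ⟨rfl, h2⟩ := hij
    rw [if_pos (by omega : 2 * i + r % 2 = 2 * i + q % 2)]
    rcases Nat.mod_two_eq_zero_or_one q with h0 | h0 <;> simp [h0, h2, hx]
  · rw [if_neg (by omega : ¬ 2 * i + r % 2 = 2 * j + q % 2), ← this]
    split_ifs with h3
    · have : ¬ (1 - q % 2 = 1 ∧ i = j) := by omega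
      simp [this]
    · have : ¬ (q % 2 = 1 ∧ i = j) := by omega
      simp [this]

theorem IsMask.pop {bh : ℕ → ℕ} {E₀ E₁ : ℕ} (h : IsMask bh E₀ E₁) (q j x : ℕ)
    (hq : bh (2 * j + q % 2) ≠ 0) : IsMask (Function.update bh (2 * j + q % 2) x)
      (E₀ ^^^ (((if x = 0 then 1 else 0) * (1 - q % 2)) <<< j))
      (E₁ ^^^ (((if x = 0 then 1 else 0) * (q % 2)) <<< j)) := by
  by_cases hx : x = 0
  · intro r i
    have h1 := h r i
    simp only [bucketBit, Nat.testBit_xor, Function.update_apply, hx, if_true, one_mul] at h1 ⊢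
    rw [testBit_shiftLeft_bit _ _ _ (by omega), testBit_shiftLeft_bit _ _ _ (by omega)]
    by_cases hij : i = j ∧ r % 2 = q % 2
    · obtain ⟨rfl, h2⟩ := hij
      rw [if_pos (by omega : 2 * i + r % 2 = 2 * i + q % 2)]
      rw [h2] at h1
      replace h1 := h1.2 hq
      rcases Nat.mod_two_eq_zero_or_one q with h0 | h0 <;> simp [h0, h2] at h1 ⊢ <;> exact h1
    · rw [if_neg (by omega : ¬ 2 * i + r % 2 = 2 * j + q % 2), ← h1]
      split_ifs with h3
      · have : ¬ (1 - q % 2 = 1 ∧ i = j) := by omega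
        simp [this]
      · have : ¬ (q % 2 = 1 ∧ i = j) := by omega
        simp [this]
  · intro r i
    simp only [hx, if_false, zero_mul, Nat.zero_shiftLeft, Nat.xor_zero, Function.update_apply]
    rw [h r i]
    split_ifs with h1
    · rw [h1]; simp [hx, hq]
    · rfl

theorem IsMask.zero {bh : ℕ → ℕ} (h : ∀ i, bh i = 0) : IsMask bh 0 0 := by
  intro q j; simp [bucketBit, h]

end Buckets

/-! ### Running programs -/

namespace RAM

/-- The value of an expression, without a bound on the words. -/
def Expr.val (σ : State) : Expr → ℕ
  | lit x => x
  | reg i => σ.reg i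
  | load addr => σ.mem (addr.val σ)
  | log2 e => Nat.log 2 (e.val σ)
  | bin op e₁ e₂ => op.eval (e₁.val σ) (e₂.val σ)

/-- All registers and memory cells hold words. -/
def State.Bounded (B : ℕ) (σ : State) : Prop := (∀ i, σ.reg i ≤ B) ∧ ∀ a, σ.mem a ≤ B

/-- No operation in the expression yields a number larger than `B`. -/
def Expr.Ok (B : ℕ) (σ : State) : Expr → Prop
  | lit x => x ≤ B
  | reg _ => True
  | load addr => addr.Ok B σ
  | log2 e => e.Ok B σ
  | bin op e₁ e₂ => e₁.Ok B σ ∧ e₂.Ok B σ ∧ op.eval (e₁.val σ) (e₂.val σ) ≤ B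

theorem Expr.eval_eq {B : ℕ} {σ : State} (hσ : σ.Bounded B) {e : Expr} (h : e.Ok B σ) :
    e.eval B σ = some (e.val σ) ∧ e.val σ ≤ B := by
  induction e with
  | lit x => exact ⟨if_pos h, h⟩
  | reg i => exact ⟨if_pos (hσ.1 i), hσ.1 i⟩
  | load a ih => simpa [eval, ih h, val, word] using hσ.2 _
  | log2 a ih =>
    have := (Nat.log_le_self 2 (a.val σ)).trans (ih h).2
    simpa [eval, ih h, val, word] using this
  | bin op a b iha ihb => simpa [eval, iha h.1, ihb h.2.1, val, word] using h.2.2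

theorem State.Bounded.assign {B : ℕ} {σ : State} (hσ : σ.Bounded B) {x : ℕ} (hx : x ≤ B) (i : ℕ) :
    State.Bounded B ⟨Function.update σ.reg i x, σ.mem⟩ := by
  refine ⟨fun j => ?_, hσ.2⟩
  by_cases h : j = i
  · simpa [h] using hx
  · simpa [h] using hσ.1 j

theorem State.Bounded.store {B : ℕ} {σ : State} (hσ : σ.Bounded B) {x : ℕ} (hx : x ≤ B) (a : ℕ) :
    State.Bounded B ⟨σ.reg, Function.update σ.mem a x⟩ := by
  refine ⟨hσ.1, fun j => ?_⟩
  by_cases h : j = a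
  · simpa [h] using hx
  · simpa [h] using hσ.2 j

/-- From `σ`, `p` halts after at most `T` steps in a state with property `Φ`. -/
def Reaches (B : ℕ) (p : Prog) (σ : State) (T : ℕ) (Φ : State → Prop) : Prop :=
  σ.Bounded B → ∃ t σ', Exec B p σ t σ' ∧ t ≤ T ∧ σ'.Bounded B ∧ Φ σ'

theorem Reaches.mono {B : ℕ} {p : Prog} {σ : State} {T T' : ℕ} {Φ Ψ : State → Prop}
    (h : Reaches B p σ T Φ) (hT : T ≤ T') (hΦ : ∀ σ', Φ σ' → Ψ σ') : Reaches B p σ T' Ψ :=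
  fun hσ => let ⟨t, σ', h1, h2, h3, h4⟩ := h hσ
  ⟨t, σ', h1, h2.trans hT, h3, hΦ _ h4⟩

theorem Reaches.seq {B : ℕ} {p q : Prog} {σ : State} {T T' : ℕ} {Φ Ψ : State → Prop}
    (hp : Reaches B p σ T Φ) (hq : ∀ σ', Φ σ' → Reaches B q σ' T' Ψ) :
    Reaches B (.seq p q) σ (T + T') Ψ :=
  fun hσ => let ⟨_, _, h1, h2, h3, h4⟩ := hp hσ
  let ⟨_, σ'', g1, g2, g3⟩ := hq _ h4 h3
  ⟨_, σ'', .seq _ _ _ _ _ _ _ h1 g1, Nat.add_le_add h2 g2, g3⟩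

theorem Reaches.ite {B : ℕ} {e : Expr} {p q : Prog} {σ : State} {T : ℕ} {Φ : State → Prop}
    (he : e.Ok B σ) (hp : e.val σ ≠ 0 → Reaches B p σ T Φ)
    (hq : e.val σ = 0 → Reaches B q σ T Φ) : Reaches B (.ite e p q) σ (e.cost + 1 + T) Φ := by
  intro hσ
  by_cases h : e.val σ = 0
  · obtain ⟨t, σ', h1, h2, h3⟩ := hq h hσ
    exact ⟨_, σ', .ite_false _ _ _ _ _ _ (h ▸ (Expr.eval_eq hσ he).1) h1, by omega, h3⟩
  · obtain ⟨t, σ', h1, h2, h3⟩ := hp h hσ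
    exact ⟨_, σ', .ite_true _ _ _ _ _ _ _ (Expr.eval_eq hσ he).1 h h1, by omega, h3⟩

theorem Reaches.loop_true {B : ℕ} {e : Expr} {p : Prog} {σ : State} {T T' : ℕ}
    {Φ Ψ : State → Prop} (he : e.Ok B σ) (h : e.val σ ≠ 0) (hp : Reaches B p σ T Φ)
    (hl : ∀ σ', Φ σ' → Reaches B (.loop e p) σ' T' Ψ) :
    Reaches B (.loop e p) σ (e.cost + 1 + T + T') Ψ :=
  fun hσ => let ⟨_, _, h1, h2, h3, h4⟩ := hp hσ
  let ⟨_, σ'', g1, g2, g3⟩ := hl _ h4 h3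
  ⟨_, σ'', .loop_true _ _ _ _ _ _ _ _ (Expr.eval_eq hσ he).1 h h1 g1, by omega, g3⟩

theorem Reaches.loop_false {B : ℕ} {e : Expr} {p : Prog} {σ : State}
    {Φ : State → Prop} (he : e.Ok B σ) (h : e.val σ = 0) (hΦ : Φ σ) :
    Reaches B (.loop e p) σ (e.cost + 1) Φ :=
  fun hσ => ⟨_, σ, .loop_false _ _ _ (h ▸ (Expr.eval_eq hσ he).1), le_rfl, hσ, hΦ⟩

/-- Sequential composition of a list of programs. -/
def Prog.block : List Prog → Prog
  | [] => skip
  | p :: l => seq p (block l)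

/-- A bound on the running time of programs without loops. -/
def Prog.cost : Prog → ℕ
  | skip => 1
  | assign _ e => e.cost + 1
  | store a e => a.cost + e.cost + 1
  | seq p q => p.cost + q.cost
  | ite e p q => e.cost + 1 + (p.cost + q.cost)
  | loop _ _ => 0

/-- Weakest preconditions of programs without loops. -/
def Prog.wp (B : ℕ) : Prog → (State → Prop) → State → Prop
  | skip, Φ, σ => Φ σ
  | assign i e, Φ, σ => e.Ok B σ ∧ Φ ⟨Function.update σ.reg i (e.val σ), σ.mem⟩
  | store a e, Φ, σ => a.Ok B σ ∧ e.Ok B σ ∧ Φ ⟨σ.reg, Function.update σ.mem (a.val σ) (e.val σ)⟩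
  | seq p q, Φ, σ => p.wp B (q.wp B Φ) σ
  | ite e p q, Φ, σ => e.Ok B σ ∧ (e.val σ ≠ 0 → p.wp B Φ σ) ∧ (e.val σ = 0 → q.wp B Φ σ)
  | loop _ _, _, _ => False

theorem Prog.reaches_of_wp {B : ℕ} {p : Prog} {Φ : State → Prop} {σ : State} (h : p.wp B Φ σ) :
    Reaches B p σ p.cost Φ := by
  induction p generalizing Φ σ with
  | skip => exact fun hσ => ⟨1, σ, .skip _, le_rfl, hσ, h⟩
  | assign i e =>
    intro hσ
    have := Expr.eval_eq hσ h.1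
    exact ⟨_, _, .assign _ _ _ _ this.1, le_rfl, hσ.assign this.2 i, h.2⟩
  | store a e =>
    intro hσ
    have := Expr.eval_eq hσ h.2.1
    exact ⟨_, _, .store _ _ _ _ _ (Expr.eval_eq hσ h.1).1 this.1, le_rfl, hσ.store this.2 _, h.2.2⟩
  | seq p q ihp ihq => exact (ihp h).seq fun σ' h' => ihq h'
  | ite e p q ihp ihq =>
    exact Reaches.ite h.1 (fun h0 => (ihp (h.2.1 h0)).mono (by omega) fun _ => id)
      (fun h0 => (ihq (h.2.2 h0)).mono (by omega) fun _ => id)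
  | loop e p => exact h.elim

variable {B : ℕ} {l : List Prog} {Φ : State → Prop} {σ : State}

theorem Prog.wp_assign {i : ℕ} {e : Expr} (x : ℕ) (hx : e.val σ = x) (he : e.Ok B σ)
    (h : (block l).wp B Φ ⟨Function.update σ.reg i x, σ.mem⟩) :
    (block (assign i e :: l)).wp B Φ σ :=
  ⟨he, hx ▸ h⟩

theorem Prog.wp_store {a e : Expr} (b x : ℕ) (hb : a.val σ = b) (hx : e.val σ = x)
    (ha : a.Ok B σ) (he : e.Ok B σ) (h : (block l).wp B Φ ⟨σ.reg, Function.update σ.mem b x⟩) :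
    (block (store a e :: l)).wp B Φ σ :=
  ⟨ha, he, hb ▸ hx ▸ h⟩

end RAM

/-! ### The program -/

namespace RAM

open RAM.Expr RAM.Prog

attribute [simp] Expr.Ok Expr.val BinOp.eval

/-- The entry `i` of the array that starts at the address in register `r`. -/
@[simp] def arr (r : ℕ) (i : Expr) : Expr := load (bin .add (reg r) i)

/-- Put the arc in register 13, with head in register 16, into its bucket. -/
def insertArc : Prog := block [
  assign 17 (bin .sub (bin .add (arr 2 (reg 13)) (reg 15)) (arr 0 (reg 16))),
  assign 18 (log2 (bin .div (reg 17) (lit 2))),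
  assign 19 (bin .add (bin .add (bin .shr (reg 10) (reg 18)) (lit 1)) (bin .lt (lit 0) (reg 17))),
  assign 20 (bin .add (reg 5) (bin .add (bin .mul (lit 2) (reg 18)) (bin .mod (reg 19) (lit 2)))),
  store (bin .add (reg 3) (reg 13)) (load (reg 20)),
  store (reg 20) (bin .add (reg 13) (lit 1)),
  assign 11 (bin .or (reg 11)
    (bin .shl (bin .sub (lit 1) (bin .mod (reg 19) (lit 2))) (reg 18))),
  assign 12 (bin .or (reg 12) (bin .shl (bin .mod (reg 19) (lit 2)) (reg 18)))]

/-- Insert the arc in register 13 unless its head is visited, and go to the next arc. -/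
def scanArc : Prog := block [
  assign 16 (arr 1 (reg 13)),
  ite (bin .eq (arr 4 (reg 16)) (reg 7)) skip insertArc,
  assign 13 (bin .add (reg 13) (lit 1))]

/-- Visit the vertex in register 9 at the time in register 10. -/
def visitVertex : Prog := block [
  store (bin .add (reg 4) (reg 9)) (reg 7),
  assign 15 (arr 0 (reg 9)),
  store (bin .add (reg 0) (reg 9)) (bin .add (reg 15) (reg 10)),
  assign 13 (load (bin .add (reg 9) (lit 4))),
  assign 14 (load (bin .add (reg 9) (lit 5)))]

/-- The lowest set bit of a word. -/
@[simp] def lowBit (e : Expr) : Expr :=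
  log2 (bin .xor e (bin .and e (bin .sub e (lit 1))))

/-- Find the level and the key of the bucket with the least time. -/
def selectBucket : Prog := block [
  assign 21 (bin .or (bin .and (reg 11) (reg 10)) (bin .xor (reg 12) (bin .and (reg 12) (reg 10)))),
  assign 22 (bin .or (bin .and (reg 12) (reg 10)) (bin .xor (reg 11) (bin .and (reg 11) (reg 10)))),
  assign 18 (lowBit (reg 21)),
  assign 24 (lowBit (reg 22)),
  assign 19 (bin .add (bin .shr (reg 10) (reg 18)) (lit 1)),
  assign 25 (bin .add (bin .shr (reg 10) (reg 24)) (lit 2)),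
  ite (bin .or (bin .eq (reg 21) (lit 0)) (bin .and (bin .lt (lit 0) (reg 22))
      (bin .lt (bin .shl (reg 25) (reg 24)) (bin .shl (reg 19) (reg 18)))))
    (block [assign 18 (reg 24), assign 19 (reg 25)]) skip]

/-- Take the first arc out of the bucket with level in register 18 and key in register 19. -/
def takeArc : Prog := block [
  assign 10 (bin .sub (bin .shl (reg 19) (reg 18)) (lit 1)),
  assign 20 (bin .add (reg 5) (bin .add (bin .mul (lit 2) (reg 18)) (bin .mod (reg 19) (lit 2)))),
  assign 13 (bin .sub (load (reg 20)) (lit 1)),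
  assign 25 (arr 3 (reg 13)),
  store (reg 20) (reg 25),
  assign 26 (bin .eq (reg 25) (lit 0)),
  assign 11 (bin .xor (reg 11) (bin .shl (bin .mul (reg 26)
    (bin .sub (lit 1) (bin .mod (reg 19) (lit 2)))) (reg 18))),
  assign 12 (bin .xor (reg 12) (bin .shl (bin .mul (reg 26)
    (bin .mod (reg 19) (lit 2))) (reg 18))),
  assign 9 (arr 1 (reg 13))]

/-- Take an arc out of the bucket with the least time, if there is any. -/
def popArc : Prog := seq (assign 8 (bin .or (reg 11) (reg 12)))
  (ite (reg 8) (seq selectBucket takeArc) skip)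

/-- One step of the search: visit the pending vertex if it is new, then take out the next arc. -/
def searchStep : Prog := seq
  (ite (bin .eq (arr 4 (reg 9)) (reg 7)) skip
    (seq visitVertex (loop (bin .lt (reg 13) (reg 14)) scanArc)))
  popArc

/-- One round: a search from the source with the current weights. -/
def searchRound : Prog := seq
  (block [assign 9 (reg 6), assign 10 (lit 0), assign 8 (lit 1)])
  (loop (reg 8) searchStep)

/-- The addresses of the arrays, and the number of rounds. -/
def layoutInit (rounds : Expr) : Prog := block [
  assign 1 (bin .add (load (lit 0)) (lit 5)),
  assign 2 (bin .add (reg 1) (load (lit 1))),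
  assign 3 (bin .add (reg 2) (load (lit 1))),
  assign 4 (bin .add (reg 3) (load (lit 1))),
  assign 0 (bin .add (reg 4) (load (lit 0))),
  assign 5 (bin .add (reg 0) (load (lit 0))),
  assign 6 (load (lit 2)),
  assign 7 rounds]

/-- The program with the given number of rounds. -/
def sumOfRounds (rounds : Expr) : Prog := seq (layoutInit rounds)
  (loop (reg 7) (seq searchRound (block [assign 7 (bin .sub (reg 7) (lit 1))])))

/-! ### Memory contents -/

variable {n m : ℕ}

/-- The number of arcs with tail below `v`. -/
def offset (G : ArcGraph n m) (v : ℕ) : ℕ :=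
  (Finset.univ.filter fun e : Fin m => (G.tail e : ℕ) < v).card

/-- The input arrays and the working arrays in memory: links of the bucket lists, round of the
last visit, sums of the outputs, and heads of the buckets. -/
structure Rep (G : ArcGraph n m) (w : Fin m → ℕ) (s : Fin n) (nxt : Fin m → ℕ)
    (vis sum : Fin n → ℕ) (bh : ℕ → ℕ) (σ : State) : Prop where
  reg0 : σ.reg 0 = 5 + 2 * n + 3 * m
  reg1 : σ.reg 1 = 5 + n
  reg2 : σ.reg 2 = 5 + n + m
  reg3 : σ.reg 3 = 5 + n + 2 * m
  reg4 : σ.reg 4 = 5 + n + 3 * m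
  reg5 : σ.reg 5 = 5 + 3 * n + 3 * m
  reg6 : σ.reg 6 = s
  off : ∀ v, v ≤ n → σ.mem (v + 4) = offset G v
  head : ∀ e : Fin m, σ.mem (5 + n + e) = G.head e
  weight : ∀ e : Fin m, σ.mem (5 + n + m + e) = w e
  link : ∀ e : Fin m, σ.mem (5 + n + 2 * m + e) = nxt e
  visit : ∀ v : Fin n, σ.mem (5 + n + 3 * m + v) = vis v
  total : ∀ v : Fin n, σ.mem (5 + 2 * n + 3 * m + v) = sum v
  bucket : ∀ i, σ.mem (5 + 3 * n + 3 * m + i) = bh i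

section Rep

variable {G : ArcGraph n m} {w : Fin m → ℕ} {s : Fin n} {nxt : Fin m → ℕ}
  {vis sum : Fin n → ℕ} {bh : ℕ → ℕ} {σ : State}

theorem Rep.assign (h : Rep G w s nxt vis sum bh σ) {i : ℕ} (hi : 6 < i) (x : ℕ) :
    Rep G w s nxt vis sum bh ⟨Function.update σ.reg i x, σ.mem⟩ := by
  obtain ⟨h0, h1, h2, h3, h4, h5, h6, h7, h8, h9, h10, h11, h12, h13⟩ := h
  have hne : ∀ j ≤ 6, Function.update σ.reg i x j = σ.reg j := fun j hj =>
    Function.update_of_ne (by omega) _ _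
  constructor <;> simp_all

theorem Rep.store (h : Rep G w s nxt vis sum bh σ) (a x : ℕ) (ha : 5 + n + 2 * m ≤ a)
    {nxt' : Fin m → ℕ} {vis' sum' : Fin n → ℕ} {bh' : ℕ → ℕ}
    (h1 : ∀ e : Fin m, nxt' e = if 5 + n + 2 * m + e = a then x else nxt e)
    (h2 : ∀ v : Fin n, vis' v = if 5 + n + 3 * m + v = a then x else vis v)
    (h3 : ∀ v : Fin n, sum' v = if 5 + 2 * n + 3 * m + v = a then x else sum v)
    (h4 : ∀ i, bh' i = if 5 + 3 * n + 3 * m + i = a then x else bh i) :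
    Rep G w s nxt' vis' sum' bh' ⟨σ.reg, Function.update σ.mem a x⟩ where
  reg0 := h.reg0
  reg1 := h.reg1
  reg2 := h.reg2
  reg3 := h.reg3
  reg4 := h.reg4
  reg5 := h.reg5
  reg6 := h.reg6
  off v hv := by
    rw [← h.off v hv]
    exact Function.update_of_ne (by omega) _ _
  head e := by
    rw [← h.head e]
    exact Function.update_of_ne (by omega) _ _
  weight e := by
    rw [← h.weight e]
    exact Function.update_of_ne (by omega) _ _
  link e := by rw [h1, ← h.link e]; exact Function.update_apply _ _ _ _
  visit v := by rw [h2, ← h.visit v]; exact Function.update_apply _ _ _ _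
  total v := by rw [h3, ← h.total v]; exact Function.update_apply _ _ _ _
  bucket i := by rw [h4, ← h.bucket i]; exact Function.update_apply _ _ _ _

theorem Rep.storeLink (h : Rep G w s nxt vis sum bh σ) (e : Fin m) (x : ℕ) :
    Rep G w s (Function.update nxt e x) vis sum bh
      ⟨σ.reg, Function.update σ.mem (5 + n + 2 * m + e) x⟩ := by
  refine h.store _ x (by omega) (fun f => ?_) (fun v => ?_) (fun v => ?_) (fun i => ?_)
  · simp [Function.update_apply, Fin.ext_iff]
  all_goals rw [if_neg (by omega)]

theorem Rep.storeVisit (h : Rep G w s nxt vis sum bh σ) (v : Fin n) (x : ℕ) :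
    Rep G w s nxt (Function.update vis v x) sum bh
      ⟨σ.reg, Function.update σ.mem (5 + n + 3 * m + v) x⟩ := by
  refine h.store _ x (by omega) (fun f => ?_) (fun v => ?_) (fun v => ?_) (fun i => ?_)
  · rw [if_neg (by omega)]
  · simp [Function.update_apply, Fin.ext_iff]
  all_goals rw [if_neg (by omega)]

theorem Rep.storeTotal (h : Rep G w s nxt vis sum bh σ) (v : Fin n) (x : ℕ) :
    Rep G w s nxt vis (Function.update sum v x) bh
      ⟨σ.reg, Function.update σ.mem (5 + 2 * n + 3 * m + v) x⟩ := by
  refine h.store _ x (by omega) (fun f => ?_) (fun v => ?_) (fun v => ?_) (fun i => ?_)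
  · rw [if_neg (by omega)]
  · rw [if_neg (by omega)]
  · simp [Function.update_apply, Fin.ext_iff]
  · rw [if_neg (by omega)]

theorem Rep.storeBucket (h : Rep G w s nxt vis sum bh σ) (i : ℕ) (x : ℕ) :
    Rep G w s nxt vis sum (Function.update bh i x)
      ⟨σ.reg, Function.update σ.mem (5 + 3 * n + 3 * m + i) x⟩ := by
  refine h.store _ x (by omega) (fun f => ?_) (fun v => ?_) (fun v => ?_) (fun i => ?_)
  · rw [if_neg (by omega)]
  · rw [if_neg (by omega)]
  · rw [if_neg (by omega)]
  · simp [Function.update_apply]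

end Rep

/-! ### The state of the search -/

/-- The bucket of an arc. -/
noncomputable def slot (G : ArcGraph n m) (W : Fin m → ℕ) (s : Fin n) (e : Fin m) : ℕ :=
  2 * level (W e) + stepKey (W e) (G.arrival W s (G.tail e)) % 2

/-- The search with weights `W`, in the round numbered `c` that started with the sums `S`, has
visited `V`, has the arcs `Q` in its buckets, and has reached the time `y`. -/
def Searching (G : ArcGraph n m) (w : Fin m → ℕ) (s : Fin n) (S : Fin n → ℕ) (W : Fin m → ℕ)
    (c : ℕ) (V : Finset (Fin n)) (Q : Finset (Fin m)) (y : ℕ) (σ : State) : Prop :=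
  ∃ nxt vis bh, Rep G w s nxt vis (fun u => S u + if u ∈ V then G.arrival W s u else 0) bh σ ∧
    (∀ u ∈ V, vis u = c) ∧ (∀ u, u ∉ V → vis u = 0 ∨ c < vis u) ∧
    IsQueue (slot G W s) Q nxt bh ∧ IsMask bh (σ.reg 11) (σ.reg 12) ∧ σ.reg 7 = c ∧ σ.reg 10 = y

theorem lt_two_pow_of_isMask {slot : Fin m → ℕ} {Q : Finset (Fin m)} {nxt : Fin m → ℕ}
    {bh : ℕ → ℕ} (hQ : IsQueue slot Q nxt bh) {E₀ E₁ t : ℕ} (hm : IsMask bh E₀ E₁)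
    (ht : ∀ e ∈ Q, slot e < 2 * t) : E₀ < 2 ^ t ∧ E₁ < 2 ^ t := by
  have key : ∀ q j, t ≤ j → bucketBit E₀ E₁ q j = false := by
    intro q j hj
    by_contra h
    obtain ⟨e, he, h1, _⟩ := hQ.pop ((hm q j).1 (by simpa using h))
    have := ht e he
    omega
  constructor
  · exact Nat.lt_pow_two_of_testBit _ fun i hi => by simpa [bucketBit] using key 0 i hi
  · exact Nat.lt_pow_two_of_testBit _ fun i hi => by simpa [bucketBit] using key 1 i hi

theorem slot_lt (G : ArcGraph n m) {W : Fin m → ℕ} (s : Fin n) {M : ℕ} (hM : 1 ≤ M)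
    (hW : ∀ e, W e ≤ M) (e : Fin m) : slot G W s e < 2 * (Nat.log 2 M + 1) := by
  have : level (W e) ≤ Nat.log 2 M :=
    Nat.le_log_of_pow_le (by norm_num) (two_pow_level_le hM (hW e))
  unfold slot
  omega

theorem two_pow_log_le {M : ℕ} (hM : 1 ≤ M) : 2 ^ (Nat.log 2 M + 1) ≤ 2 * M := by
  have := Nat.pow_log_le_self 2 (x := M) (by omega)
  rw [pow_succ]; omega

/-- The sizes of the numbers in a round: weights up to `M`, sums and times up to `X`. -/
structure Sizes (G : ArcGraph n m) (w : Fin m → ℕ) (s : Fin n) (S : Fin n → ℕ) (W : Fin m → ℕ)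
    (M X B : ℕ) : Prop where
  reach : G.AllReachable s
  one_le : 1 ≤ M
  weight_le : ∀ e, W e ≤ M
  sum_le : ∀ v, S v ≤ X
  arrival_le : ∀ v, G.arrival W s v + M ≤ X
  weight_add : ∀ e, W e + S (G.head e) = w e + S (G.tail e)
  room : 10 + 3 * n + 3 * m + 10 * M + 2 * X ≤ B

variable {G : ArcGraph n m} {w : Fin m → ℕ} {s : Fin n} {S : Fin n → ℕ} {W : Fin m → ℕ}
  {M X B c y : ℕ} {V : Finset (Fin n)} {Q : Finset (Fin m)} {σ : State}

theorem insertArc_spec (hB : Sizes G w s S W M X B) (h : Searching G w s S W c V Q y σ)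
    {e : Fin m} (h13 : σ.reg 13 = e) (h15 : σ.reg 15 = S (G.tail e)) (h16 : σ.reg 16 = G.head e)
    (hV : G.head e ∉ V) (hQ : e ∉ Q) (hy : y = G.arrival W s (G.tail e)) :
    insertArc.wp B (fun σ' => Searching G w s S W c V (insert e Q) y σ' ∧
      σ'.reg 13 = e ∧ σ'.reg 14 = σ.reg 14 ∧ σ'.reg 15 = σ.reg 15) σ := by
  obtain ⟨nxt, vis, bh, hr, hv1, hv2, hq, hm, h7, h10⟩ := h
  have hroom := hB.room
  have hM := hB.one_le
  have hW := hB.weight_le e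
  have hX := hB.arrival_le (G.tail e)
  have hS := hB.sum_le (G.head e)
  have hwt := hB.weight_add e
  have hl := two_pow_level_le hM hW
  have hlt : level (W e) < 2 ^ level (W e) := Nat.lt_two_pow_self
  have hslot : slot G W s e = 2 * level (W e) + stepKey (W e) y % 2 := by rw [slot, hy]
  have hkey : stepKey (W e) y ≤ y + 2 := by
    have := Nat.div_le_self y (2 ^ level (W e))
    unfold stepKey; omega
  have hq' := hq.push hQ
  have hm' := hm.push (stepKey (W e) y) (level (W e)) (x := e + 1) (by omega)
  rw [← hslot] at hm'
  obtain ⟨b0, b1⟩ := lt_two_pow_of_isMask hq' hm' (t := Nat.log 2 M + 1)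
    fun f _ => slot_lt G s hM hB.weight_le f
  have ht := two_pow_log_le hM
  have s0 : ∀ b, b ≤ 1 → b <<< level (W e) ≤ M := fun b hb => by
    rw [Nat.shiftLeft_eq]
    exact (Nat.mul_le_mul_right _ hb).trans (by omega)
  have s1 := s0 (stepKey (W e) y % 2) (by omega)
  have s2 := s0 (1 - stepKey (W e) y % 2) (by omega)
  have hhead := (G.head e).2
  have hlow := e.2
  have hbh := hr.bucket (slot G W s e)
  have hr1 := hr.weight e
  have hr2 := hr.total (G.head e)
  simp only [hV, if_false, add_zero] at hr2
  unfold insertArc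
  refine wp_assign (W e) ?_ ?_ ?_
  · simp [hr.reg0, hr.reg2, h13, h15, h16, hr1, hr2]
    omega
  · simp [hr.reg0, hr.reg2, h13, h15, h16, hr1, hr2]
    omega
  refine wp_assign (level (W e)) ?_ ?_ ?_
  · simp [level]
  · simp; omega
  refine wp_assign (stepKey (W e) y) ?_ ?_ ?_
  · simp [stepKey, h10, Nat.shiftRight_eq_div_pow]
    split_ifs <;> omega
  · simp [h10, Nat.shiftRight_eq_div_pow]
    have := Nat.div_le_self y (2 ^ level (W e))
    split_ifs <;> omega
  refine wp_assign (5 + 3 * n + 3 * m + slot G W s e) ?_ ?_ ?_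
  · simp [hr.reg5, hslot]
  · simp [hr.reg5]; omega
  refine wp_store (5 + n + 2 * m + e) (bh (slot G W s e)) ?_ ?_ ?_ ?_ ?_
  · simp [hr.reg3, h13]
  · simp [hbh]
  · simp [hr.reg3, h13]; omega
  · simp
  refine wp_store (5 + 3 * n + 3 * m + slot G W s e) (e + 1) ?_ ?_ ?_ ?_ ?_
  · simp
  · simp [h13]
  · simp
  · simp [h13]; omega
  refine wp_assign _ rfl ?_ ?_
  · simp
    omega
  refine wp_assign _ rfl ?_ ?_
  · simp
    omega
  refine ⟨⟨_, vis, _, (((((((hr.assign (i := 17) (by omega) _).assign (i := 18) (by omega) _).assign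
    (i := 19) (by omega) _).assign (i := 20) (by omega) _).storeLink e _).storeBucket _ _).assign
    (i := 11) (by omega) _).assign (i := 12) (by omega) _, hv1, hv2, hq', ?_, ?_, ?_⟩, ?_, ?_, ?_⟩
  · simpa using hm'
  all_goals simp [h7, h10, h13]

/-! ### Scanning the arcs of a vertex -/

theorem lt_offset_iff (hG : Monotone G.tail) (e : Fin m) (v : ℕ) :
    (e : ℕ) < offset G v ↔ (G.tail e : ℕ) < v := by
  unfold offset
  constructor
  · intro h
    by_contra hv
    have : (Finset.univ.filter fun e : Fin m => (G.tail e : ℕ) < v) ⊆ Finset.Iio e := by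
      intro f hf
      simp only [Finset.mem_filter, Finset.mem_univ, true_and] at hf
      rw [Finset.mem_Iio]
      by_contra hfe
      have : (G.tail e : ℕ) ≤ G.tail f := hG (not_lt.1 hfe)
      omega
    have := Finset.card_le_card this
    rw [Fin.card_Iio] at this
    omega
  · intro h
    have : Finset.Iic e ⊆ Finset.univ.filter fun e : Fin m => (G.tail e : ℕ) < v := by
      intro f hf
      have : (G.tail f : ℕ) ≤ G.tail e := hG (Finset.mem_Iic.1 hf)
      simp only [Finset.mem_filter, Finset.mem_univ, true_and]
      omega
    have := Finset.card_le_card this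
    rw [Fin.card_Iic] at this
    omega

theorem ite_le (hB : 1 ≤ B) (p : Prop) [Decidable p] : (if p then 1 else 0) ≤ B := by
  split_ifs <;> omega

theorem offset_le (G : ArcGraph n m) (v : ℕ) : offset G v ≤ m :=
  (Finset.card_le_univ _).trans (by simp)

theorem scanArc_spec (hc : 0 < c) (hB : Sizes G w s S W M X B) (h : Searching G w s S W c V Q y σ)
    {e : Fin m} (h13 : σ.reg 13 = e) (h15 : σ.reg 15 = S (G.tail e)) (hQ : e ∉ Q)
    (hy : y = G.arrival W s (G.tail e)) :
    Reaches B scanArc σ 200 (fun σ' =>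
      Searching G w s S W c V (if G.head e ∈ V then Q else insert e Q) y σ' ∧
      σ'.reg 13 = e + 1 ∧ σ'.reg 14 = σ.reg 14 ∧ σ'.reg 15 = σ.reg 15) := by
  obtain ⟨nxt, vis, bh, hr, hv1, hv2, hq, hm, h7, h10⟩ := h
  have hroom := hB.room
  have hhead := (G.head e).2
  have hlow := e.2
  have hr1 := hr.head e
  have hr2 := hr.visit (G.head e)
  have last : ∀ {Q'} {σ' : State}, Searching G w s S W c V Q' y σ' → σ'.reg 13 = e →
      σ'.reg 14 = σ.reg 14 → σ'.reg 15 = σ.reg 15 →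
      (block [assign 13 (bin .add (reg 13) (lit 1))]).wp B (fun σ' =>
        Searching G w s S W c V Q' y σ' ∧
        σ'.reg 13 = e + 1 ∧ σ'.reg 14 = σ.reg 14 ∧ σ'.reg 15 = σ.reg 15) σ' := by
    intro Q' σ' hσ' g13 g14 g15
    obtain ⟨nxt, vis, bh, hr, hv1, hv2, hq, hm, h7, h10⟩ := hσ'
    refine wp_assign (e + 1) ?_ ?_ ?_
    · simp [g13]
    · simp [g13]; omega
    refine ⟨⟨nxt, vis, bh, hr.assign (by omega) _, hv1, hv2, hq, ?_⟩, ?_⟩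
    · simpa [h7, h10] using hm
    · simp [g14, g15]
  unfold scanArc
  have hone : (assign 16 (arr 1 (reg 13))).wp B (fun σ' => σ' =
      ⟨Function.update σ.reg 16 (G.head e), σ.mem⟩) σ := by
    refine ⟨?_, ?_⟩
    · simp [h13, hr.reg1]; omega
    · simp [h13, hr.reg1, hr1]
  refine ((reaches_of_wp hone).seq (T' := 190) ?_).mono ?_ fun _ => id
  · rintro σ' rfl
    have hs : Searching G w s S W c V Q y ⟨Function.update σ.reg 16 (G.head e), σ.mem⟩ :=
      ⟨nxt, vis, bh, hr.assign (by omega) _, hv1, hv2, hq, by simpa [h7, h10] using hm⟩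
    refine (Reaches.seq (Φ := fun σ' =>
      Searching G w s S W c V (if G.head e ∈ V then Q else insert e Q) y σ' ∧
      σ'.reg 13 = e ∧ σ'.reg 14 = σ.reg 14 ∧ σ'.reg 15 = σ.reg 15)
      (Reaches.ite (T := insertArc.cost) ?_ ?_ ?_) ?_ (T' := 10)).mono ?_ fun _ => id
    · simp [hr.reg4, hr2]
      refine ⟨by omega, ?_⟩
      split_ifs <;> omega
    · intro hne
      have hV : G.head e ∈ V := by
        by_contra hV
        have := hv2 _ hV
        simp [hr.reg4, hr2, h7] at hne
        omega
      rw [if_pos hV]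
      refine (reaches_of_wp (p := skip) ?_).mono (by decide) fun _ => id
      exact ⟨hs, by simp [h13], by simp, by simp⟩
    · intro he
      have hV : G.head e ∉ V := by
        intro hV
        simp [hr.reg4, hr2, h7, hv1 _ hV] at he
      rw [if_neg hV]
      refine (reaches_of_wp (insertArc_spec hB hs (by simpa using h13) (by simpa using h15)
        (by simp) hV hQ hy)).mono le_rfl ?_
      simp
    · rintro σ' ⟨g, g13, g14, g15⟩
      exact (reaches_of_wp (last g g13 g14 g15)).mono (by decide) fun _ => id
    · decide
  · decide

theorem scanLoop_spec (hc : 0 < c) (hG : Monotone G.tail) (hB : Sizes G w s S W M X B) {v : Fin n}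
    (hy : y = G.arrival W s v) (k : ℕ) : ∀ {Q : Finset (Fin m)} {σ : State} {i : ℕ},
    Searching G w s S W c V Q y σ → i + k = offset G (v + 1) → offset G v ≤ i → σ.reg 13 = i →
    σ.reg 14 = offset G (v + 1) → σ.reg 15 = S v → (∀ e : Fin m, G.tail e = v → i ≤ e → e ∉ Q) →
    Reaches B (loop (bin .lt (reg 13) (reg 14)) scanArc) σ (210 * k + 4) (Searching G w s S W c V
      (Q ∪ Finset.univ.filter fun e => G.tail e = v ∧ i ≤ e ∧ G.head e ∉ V) y) := by
  have hroom := hB.room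
  induction k with
  | zero =>
    intro Q σ i h hk hi h13 h14 h15 hQ
    refine (Reaches.loop_false ?_ ?_ ?_).mono (by decide) fun _ => id
    · simpa using ite_le (by omega) _
    · simp [h13, h14, ← hk]
    · have : (Finset.univ.filter fun e => G.tail e = v ∧ i ≤ (e : ℕ) ∧ G.head e ∉ V) = ∅ := by
        refine Finset.filter_eq_empty_iff.2 ?_
        rintro e - ⟨rfl, h2, -⟩
        have := (lt_offset_iff hG e (G.tail e + 1)).2 (by omega)
        omega
      rwa [this, Finset.union_empty]
  | succ k ih =>
    intro Q σ i h hk hi h13 h14 h15 hQ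
    have him : i < m := by have := offset_le G (v + 1); omega
    have htail : G.tail ⟨i, him⟩ = v := by
      have h1 := (lt_offset_iff hG ⟨i, him⟩ (v + 1)).1 (by simp; omega)
      have h2 := (lt_offset_iff hG ⟨i, him⟩ v).not.1 (by simp; omega)
      omega
    refine (Reaches.loop_true ?_ ?_ (scanArc_spec hc hB h (e := ⟨i, him⟩) h13 (by rw [htail, h15])
      (hQ _ htail le_rfl) (by rw [htail, hy])) (T' := 210 * k + 4) ?_).mono ?_ fun _ => id
    · simpa using ite_le (by omega) _
    · simp [h13, h14]; omega
    · rintro σ' ⟨g, g13, g14, g15⟩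
      have := ih (i := i + 1) g (by omega) (by omega) g13 (g14.trans h14) (g15.trans h15) ?_
      · refine this.mono le_rfl fun σ' hσ' => ?_
        convert hσ' using 1
        ext f
        have hf : f = ⟨i, him⟩ ↔ (f : ℕ) = i := Fin.ext_iff
        simp only [Finset.mem_union, Finset.mem_filter, Finset.mem_univ, true_and]
        by_cases hfi : (f : ℕ) = i
        · obtain rfl : f = ⟨i, him⟩ := hf.2 hfi
          by_cases hV : G.head ⟨i, him⟩ ∈ V <;> simp [hV, htail]
        · have h1 : i + 1 ≤ (f : ℕ) ↔ i ≤ f := by omega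
          rw [h1]
          split_ifs
          · rfl
          · simp [Finset.mem_insert, hf, hfi]
      · intro f hf hif
        have := hQ f hf (by omega)
        split_ifs
        · exact this
        · simp only [Finset.mem_insert, not_or]
          exact ⟨by rintro rfl; simp at hif, this⟩
    · simp only [Expr.cost]; omega

theorem visitVertex_spec (hB : Sizes G w s S W M X B) (h : Searching G w s S W c V Q y σ)
    {v : Fin n} (h9 : σ.reg 9 = v) (hv : v ∉ V) (hy : y = G.arrival W s v) :
    visitVertex.wp B (fun σ' => Searching G w s S W c (insert v V) Q y σ' ∧
      σ'.reg 13 = offset G v ∧ σ'.reg 14 = offset G (v + 1) ∧ σ'.reg 15 = S v) σ := by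
  obtain ⟨nxt, vis, bh, hr, hv1, hv2, hq, hm, h7, h10⟩ := h
  have hroom := hB.room
  have hvn := v.2
  have hS := hB.sum_le v
  have hA := hB.arrival_le v
  have hr1 := hr.total v
  simp only [hv, if_false, add_zero] at hr1
  have hr2 := hr.off v hvn.le
  have hr3 := hr.off (v + 1) hvn
  unfold visitVertex
  refine wp_store (5 + n + 3 * m + v) c ?_ ?_ ?_ ?_ ?_
  · simp [hr.reg4, h9]
  · simp [h7]
  · simp [hr.reg4, h9]; omega
  · simp
  have g1 := hr.storeVisit v c
  have t1 := g1.total v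
  simp only [hv, if_false, add_zero] at t1
  refine wp_assign (S v) ?_ ?_ ?_
  · simp only [val, arr, BinOp.eval, hr.reg0, h9]; exact t1
  · simp [hr.reg0, h9]; omega
  have g2 := g1.assign (i := 15) (by omega) (S v)
  refine wp_store (5 + 2 * n + 3 * m + v) (S v + y) ?_ ?_ ?_ ?_ ?_
  · simp [hr.reg0, h9]
  · simp [h10]
  · simp [hr.reg0, h9]; omega
  · simp [h10]; omega
  have g3 := g2.storeTotal v (S v + y)
  have t2 := g3.off v hvn.le
  have t3 := g3.off (v + 1) hvn
  refine wp_assign (offset G v) ?_ ?_ ?_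
  · simpa [h9, Function.update_apply] using t2
  · simp [h9]; omega
  refine wp_assign (offset G (v + 1)) ?_ ?_ ?_
  · simpa [h9, Function.update_apply] using t3
  · simp [h9]; omega
  refine ⟨⟨nxt, Function.update vis v c, bh, ?_, ?_, ?_, hq, ?_, ?_, ?_⟩, ?_, ?_, ?_⟩
  · have g4 := (g3.assign (i := 13) (by omega) (offset G v)).assign (i := 14) (by omega)
      (offset G (v + 1))
    convert g4 using 1
    funext u
    by_cases hu : u = v
    · subst hu; simp [hy]
    · simp [hu]
  · intro u hu
    by_cases huv : u = v
    · subst huv; simp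
    · rw [Function.update_of_ne huv]
      exact hv1 u (by simpa [huv] using hu)
  · intro u hu
    simp only [Finset.mem_insert, not_or] at hu
    rw [Function.update_of_ne hu.1]
    exact hv2 u hu.2
  · simpa using hm
  all_goals simp [h7, h10]

/-! ### Invariants of the search -/

/-- The time of arrival at the head of an arc. -/
noncomputable def arcTime (G : ArcGraph n m) (W : Fin m → ℕ) (s : Fin n) (e : Fin m) : ℕ :=
  relax (W e) (G.arrival W s (G.tail e))

/-- All vertices with arrival before `y` are in `V`, and `Q` holds the arcs that leave `V`. -/
structure Frontier (G : ArcGraph n m) (W : Fin m → ℕ) (s : Fin n) (X : ℕ) (V : Finset (Fin n))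
    (Q : Finset (Fin m)) (y : ℕ) : Prop where
  le : ∀ u ∈ V, G.arrival W s u ≤ y
  queue : ∀ e ∈ Q, G.tail e ∈ V ∧ y ≤ arcTime G W s e
  out : ∀ e, G.tail e ∈ V → G.head e ∉ V → e ∈ Q
  source : s ∈ V
  bound : y ≤ X

/-- The same while the vertex `v` is reached at time `y`, and has not been dealt with. -/
structure Pending (G : ArcGraph n m) (W : Fin m → ℕ) (s : Fin n) (X : ℕ) (V : Finset (Fin n))
    (Q : Finset (Fin m)) (y : ℕ) (v : Fin n) : Prop where
  le : ∀ u ∈ V, G.arrival W s u ≤ y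
  queue : ∀ e ∈ Q, G.tail e ∈ V ∧ y ≤ arcTime G W s e
  out : ∀ e, G.tail e ∈ V → G.head e ∉ V → y ≤ arcTime G W s e ∧ (e ∈ Q ∨ G.head e = v)
  source : s ∈ V ∨ v = s ∧ y = 0
  arrived : G.arrival W s v ≤ y
  bound : y ≤ X

theorem Pending.eq_arrival {v : Fin n} (h : Pending G W s X V Q y v) (hs : G.AllReachable s)
    (hv : v ∉ V) : y = G.arrival W s v := by
  refine le_antisymm ?_ h.arrived
  rcases h.source with hsV | ⟨-, h0⟩
  · have key : ∀ p a, a ∈ V → G.IsWalk a p v →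
        y ≤ ArcGraph.walkTime W (G.arrival W s a) p := by
      intro p
      induction p with
      | nil => rintro a ha rfl; exact absurd ha hv
      | cons e p ih =>
        rintro a ha ⟨rfl, hp⟩
        by_cases hV : G.head e ∈ V
        · exact (ih _ hV hp).trans (ArcGraph.walkTime_mono W p (ArcGraph.arrival_head_le W hs e))
        · exact (h.out e ha hV).1.trans (ArcGraph.le_walkTime W p _)
    obtain ⟨p, hp, hpa⟩ := ArcGraph.exists_walkTime_eq_arrival W hs v
    rw [← hpa, ← ArcGraph.arrival_self G W s]
    exact key p s hsV hp
  · omega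

theorem Pending.frontier_of_mem {v : Fin n} (h : Pending G W s X V Q y v) (hv : v ∈ V) :
    Frontier G W s X V Q y where
  le := h.le
  queue := h.queue
  out e he he' := (h.out e he he').2.resolve_right (by rintro rfl; exact he' hv)
  source := h.source.elim id fun hs => hs.1 ▸ hv
  bound := h.bound

theorem Pending.frontier_insert {v : Fin n} (h : Pending G W s X V Q y v)
    (hy : y = G.arrival W s v) : Frontier G W s X (insert v V)
      (Q ∪ Finset.univ.filter fun e => G.tail e = v ∧ G.head e ∉ insert v V) y where
  le := by
    intro u hu
    rcases Finset.mem_insert.1 hu with rfl | hu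
    · exact hy.ge
    · exact h.le u hu
  queue := by
    intro e he
    rcases Finset.mem_union.1 he with he | he
    · exact ⟨Finset.mem_insert_of_mem (h.queue e he).1, (h.queue e he).2⟩
    · obtain ⟨-, rfl, -⟩ := Finset.mem_filter.1 he
      exact ⟨Finset.mem_insert_self _ _, hy.le.trans (le_relax _ _)⟩
  out := by
    intro e he he'
    rw [Finset.mem_union, Finset.mem_filter]
    rcases Finset.mem_insert.1 he with he | he
    · exact Or.inr ⟨Finset.mem_univ _, he, he'⟩
    · simp only [Finset.mem_insert, not_or] at he'
      exact Or.inl ((h.out e he he'.2).2.resolve_right he'.1)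
  source := h.source.elim Finset.mem_insert_of_mem fun hs => hs.1 ▸ Finset.mem_insert_self _ _
  bound := h.bound

theorem Frontier.pending (hB : Sizes G w s S W M X B) (h : Frontier G W s X V Q y) {e : Fin m}
    (he : e ∈ Q) (hmin : ∀ f ∈ Q, arcTime G W s e ≤ arcTime G W s f) :
    Pending G W s X V (Q.erase e) (arcTime G W s e) (G.head e) where
  le u hu := (h.le u hu).trans (h.queue e he).2
  queue f hf := ⟨(h.queue f (Finset.mem_of_mem_erase hf)).1, hmin f (Finset.mem_of_mem_erase hf)⟩
  out f hf hf' := by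
    have hfQ := h.out f hf hf'
    refine ⟨hmin f hfQ, ?_⟩
    by_cases hfe : f = e
    · exact Or.inr (hfe ▸ rfl)
    · exact Or.inl (Finset.mem_erase.2 ⟨hfe, hfQ⟩)
  source := Or.inl h.source
  arrived := ArcGraph.arrival_head_le W hB.reach e
  bound := by
    have := (relax_bounds (W e) (G.arrival W s (G.tail e))).2
    have := hB.weight_le e
    have := hB.arrival_le (G.tail e)
    unfold arcTime
    omega

theorem Frontier.eq_univ (h : Frontier G W s X V ∅ y) (hs : G.AllReachable s) :
    V = Finset.univ := by
  refine Finset.eq_univ_of_forall fun v => ?_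
  obtain ⟨p, hp⟩ := hs v
  have key : ∀ p a, a ∈ V → G.IsWalk a p v → v ∈ V := by
    intro p
    induction p with
    | nil => rintro a ha rfl; exact ha
    | cons e p ih =>
      rintro a ha ⟨rfl, hp⟩
      refine ih _ ?_ hp
      by_contra hV
      simpa using h.out e ha hV
  exact key p s h.source hp

/-! ### Taking out the next arc -/

theorem Frontier.stepKey_eq (h : Frontier G W s X V Q y) {e : Fin m} (he : e ∈ Q) :
    stepKey (W e) (G.arrival W s (G.tail e)) = y / 2 ^ level (W e) + 1 ∨
    stepKey (W e) (G.arrival W s (G.tail e)) = y / 2 ^ level (W e) + 2 := by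
  obtain ⟨h1, h2⟩ := h.queue e he
  have h3 : G.arrival W s (G.tail e) / 2 ^ level (W e) ≤ y / 2 ^ level (W e) :=
    Nat.div_le_div_right (h.le _ h1)
  have h4 := relax_add_one (W e) (G.arrival W s (G.tail e))
  unfold arcTime at h2
  have h5 : y / 2 ^ level (W e) < stepKey (W e) (G.arrival W s (G.tail e)) := by
    rw [Nat.div_lt_iff_lt_mul (Nat.two_pow_pos _)]
    omega
  have h6 : stepKey (W e) (G.arrival W s (G.tail e)) ≤
      G.arrival W s (G.tail e) / 2 ^ level (W e) + 2 := by
    unfold stepKey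
    omega
  omega

theorem selectBucket_spec (hB : Sizes G w s S W M X B) (h : Searching G w s S W c V Q y σ)
    (hF : Frontier G W s X V Q y) (hE : σ.reg 11 ||| σ.reg 12 ≠ 0) :
    selectBucket.wp B (fun σ' => Searching G w s S W c V Q y σ' ∧ σ'.reg 8 = σ.reg 8 ∧
      IsNext (σ'.reg 11) (σ'.reg 12) y (σ'.reg 18) (σ'.reg 19)) σ := by
  obtain ⟨nxt, vis, bh, hr, hv1, hv2, hq, hm, h7, h10⟩ := h
  have hroom := hB.room
  have hM := hB.one_le
  have hyX := hF.bound
  obtain ⟨N, hN⟩ : ∃ N, N = (σ.reg 11 &&& y) ||| (σ.reg 12 ^^^ (σ.reg 12 &&& y)) := ⟨_, rfl⟩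
  obtain ⟨N', hN'⟩ : ∃ N, N = (σ.reg 12 &&& y) ||| (σ.reg 11 ^^^ (σ.reg 11 &&& y)) := ⟨_, rfl⟩
  obtain ⟨a, ha⟩ : ∃ a, a = Nat.log 2 (N ^^^ (N &&& (N - 1))) := ⟨_, rfl⟩
  obtain ⟨b, hb⟩ : ∃ b, b = Nat.log 2 (N' ^^^ (N' &&& (N' - 1))) := ⟨_, rfl⟩
  obtain ⟨sel1, sel2⟩ := isNext_select hE hN hN' ha hb
  obtain ⟨b0, b1⟩ := lt_two_pow_of_isMask hq hm (t := Nat.log 2 M + 1)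
    fun f _ => slot_lt G s hM hB.weight_le f
  have ht := two_pow_log_le hM
  have a0 : σ.reg 11 &&& y ≤ σ.reg 11 := Nat.and_le_left
  have a1 : σ.reg 12 &&& y ≤ σ.reg 12 := Nat.and_le_left
  have x0 := Nat.xor_lt_two_pow b0 (a0.trans_lt b0)
  have x1 := Nat.xor_lt_two_pow b1 (a1.trans_lt b1)
  have n0 := Nat.or_lt_two_pow (a0.trans_lt b0) x1
  have n1 := Nat.or_lt_two_pow (a1.trans_lt b1) x0
  rw [← hN] at n0
  rw [← hN'] at n1
  have l0 : ∀ x : ℕ, x < 2 ^ (Nat.log 2 M + 1) →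
      x &&& (x - 1) ≤ x ∧ x ^^^ (x &&& (x - 1)) < 2 ^ (Nat.log 2 M + 1) := fun x hx =>
    ⟨Nat.and_le_left, Nat.xor_lt_two_pow hx (Nat.and_le_left.trans_lt hx)⟩
  have l1 : ∀ x : ℕ, x < 2 ^ (Nat.log 2 M + 1) →
      2 ^ (Nat.log 2 (x ^^^ (x &&& (x - 1)))) ≤ 2 * M := fun x hx => by
    rcases Nat.eq_zero_or_pos (x ^^^ (x &&& (x - 1))) with h0 | h0
    · rw [h0]; simp; omega
    · have := Nat.pow_log_le_self 2 h0.ne'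
      have := (l0 x hx).2
      omega
  have la := l1 N n0
  have lb := l1 N' n1
  rw [← ha] at la
  rw [← hb] at lb
  have s0 : ∀ i k, 2 ^ i ≤ 2 * M → k ≤ 2 → (y / 2 ^ i + k) * 2 ^ i ≤ X + 4 * M := by
    intro i k hi hk
    have h1 := Nat.div_mul_le_self y (2 ^ i)
    have h2 : k * 2 ^ i ≤ 2 * (2 * M) := Nat.mul_le_mul hk hi
    rw [add_mul]
    omega
  have sa := s0 a 1 la (by norm_num)
  have sb := s0 b 2 lb le_rfl
  have da := Nat.div_le_self y (2 ^ a)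
  have db := Nat.div_le_self y (2 ^ b)
  obtain ⟨p0, p1⟩ := l0 N n0
  obtain ⟨p2, p3⟩ := l0 N' n1
  unfold selectBucket
  refine wp_assign N ?_ ?_ ?_
  · simp [hN, h10]
  · simp only [Ok, val, BinOp.eval, h10, true_and, ← hN]
    omega
  refine wp_assign N' ?_ ?_ ?_
  · simp [hN', h10]
  · simp [h10, ← hN']
    omega
  refine wp_assign a ?_ ?_ ?_
  · simp [ha]
  · simp
    omega
  refine wp_assign b ?_ ?_ ?_
  · simp [hb]
  · simp
    omega
  refine wp_assign (y / 2 ^ a + 1) ?_ ?_ ?_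
  · simp [h10, Nat.shiftRight_eq_div_pow]
  · simp [h10, Nat.shiftRight_eq_div_pow]
    omega
  refine wp_assign (y / 2 ^ b + 2) ?_ ?_ ?_
  · simp [h10, Nat.shiftRight_eq_div_pow]
  · simp [h10, Nat.shiftRight_eq_div_pow]
    omega
  have hcond : ∀ p q r : Prop, ∀ [Decidable p] [Decidable q] [Decidable r],
      ((if p then 1 else 0) ||| ((if q then 1 else 0) &&& (if r then 1 else 0)) : ℕ) =
        if p ∨ q ∧ r then 1 else 0 := by
    intro p q r _ _ _
    by_cases p <;> by_cases q <;> by_cases r <;> simp_all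
  have hr' := (((((hr.assign (i := 21) (by omega) N).assign (i := 22) (by omega) N').assign
    (i := 18) (by omega) a).assign (i := 24) (by omega) b).assign (i := 19) (by omega)
    (y / 2 ^ a + 1)).assign (i := 25) (by omega) (y / 2 ^ b + 2)
  have hpos : N' ≠ 0 ↔ 0 < N' := Nat.pos_iff_ne_zero.symm
  rw [hpos] at sel1 sel2
  refine ⟨?_, ?_, ?_⟩
  · have i1 := fun p [Decidable p] => ite_le (B := B) (by omega) p
    simp only [Ok, val, BinOp.eval, Function.update_apply, Nat.shiftLeft_eq, hcond]
    simp [i1]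
    exact ⟨by omega, Nat.and_le_left.trans (i1 _)⟩
  · intro hne
    simp only [val, BinOp.eval, Function.update_apply, Nat.shiftLeft_eq, hcond] at hne
    simp only [reduceIte, Nat.reduceEqDiff, ne_eq, ite_eq_right_iff, one_ne_zero, imp_false,
      not_not] at hne
    refine wp_assign b ?_ ?_ ?_
    · simp
    · simp
    refine wp_assign (y / 2 ^ b + 2) ?_ ?_ ?_
    · simp
    · simp
    refine ⟨⟨nxt, vis, bh, (hr'.assign (i := 18) (by omega) b).assign (i := 19) (by omega)
      (y / 2 ^ b + 2), hv1, hv2, hq, ?_, ?_, ?_⟩, ?_, ?_⟩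
    · simpa using hm
    · simp [h7]
    · simp [h10]
    · simp
    · simpa using sel1 hne
  · intro he
    simp only [val, BinOp.eval, Function.update_apply, Nat.shiftLeft_eq, hcond] at he
    simp only [reduceIte, Nat.reduceEqDiff, ite_eq_right_iff, one_ne_zero, imp_false] at he
    refine ⟨⟨nxt, vis, bh, hr', hv1, hv2, hq, ?_, ?_, ?_⟩, ?_, ?_⟩
    · simpa using hm
    · simp [h7]
    · simp [h10]
    · simp
    · simpa using sel2 he

theorem takeArc_spec (hB : Sizes G w s S W M X B) (h : Searching G w s S W c V Q y σ)
    (hF : Frontier G W s X V Q y)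
    (hN : IsNext (σ.reg 11) (σ.reg 12) y (σ.reg 18) (σ.reg 19)) :
    takeArc.wp B (fun σ' => ∃ e ∈ Q, (∀ f ∈ Q, arcTime G W s e ≤ arcTime G W s f) ∧
      Searching G w s S W c V (Q.erase e) (arcTime G W s e) σ' ∧ σ'.reg 9 = G.head e ∧
      σ'.reg 8 = σ.reg 8) σ := by
  obtain ⟨nxt, vis, bh, hr, hv1, hv2, hq, hm, h7, h10⟩ := h
  obtain ⟨i, hi⟩ : ∃ i, σ.reg 18 = i := ⟨_, rfl⟩
  obtain ⟨q, hqr⟩ : ∃ q, σ.reg 19 = q := ⟨_, rfl⟩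
  rw [hi, hqr] at hN
  obtain ⟨N1, N2, N3⟩ := hN
  have hroom := hB.room
  have hM := hB.one_le
  have hbh := (hm q i).1 N1
  obtain ⟨e, he, hse, hbe, hq'⟩ := hq.pop hbh
  have hm' := hm.pop q i (nxt e) hbh
  have hlev : level (W e) = i := by unfold slot at hse; omega
  have hkey : stepKey (W e) (G.arrival W s (G.tail e)) = q := by
    have := hF.stepKey_eq he
    unfold slot at hse
    rw [hlev] at this
    omega
  have htime : arcTime G W s e + 1 = q * 2 ^ i := by
    unfold arcTime
    rw [relax_add_one, hkey, hlev]
  have hmin : ∀ f ∈ Q, arcTime G W s e ≤ arcTime G W s f := by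
    intro f hf
    have h1 := relax_add_one (W f) (G.arrival W s (G.tail f))
    have h2 := hq.bh_ne_zero hf
    have h3 := N3 (level (W f)) (stepKey (W f) (G.arrival W s (G.tail f))) ((hm _ _).2 h2)
      (hF.stepKey_eq hf)
    rw [← htime, ← h1] at h3
    exact Nat.le_of_add_le_add_right h3
  have hX := (hF.pending hB he hmin).bound
  have hl := hlev ▸ two_pow_level_le hM (hB.weight_le e)
  have hlt : i < 2 ^ i := Nat.lt_two_pow_self
  have hq1 : q ≤ q * 2 ^ i := Nat.le_mul_of_pos_right q (Nat.two_pow_pos i)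
  obtain ⟨b0, b1⟩ := lt_two_pow_of_isMask hq' hm' (t := Nat.log 2 M + 1)
    fun f _ => slot_lt G s hM hB.weight_le f
  have ht := two_pow_log_le hM
  obtain ⟨z, hz⟩ : ∃ z, z = if nxt e = 0 then 1 else 0 := ⟨_, rfl⟩
  have hz1 : z ≤ 1 := by rw [hz]; split_ifs <;> omega
  rw [← hz] at b0 b1 hm'
  have s0 : ∀ b, b ≤ 1 → z * b ≤ 1 ∧ (z * b) <<< i ≤ M := fun b hb => by
    have h1 : z * b ≤ 1 := Nat.mul_le_mul hz1 hb
    rw [Nat.shiftLeft_eq]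
    exact ⟨h1, (Nat.mul_le_mul_right _ h1).trans (by omega)⟩
  obtain ⟨s1, s2⟩ := s0 (q % 2) (by omega)
  obtain ⟨s3, s4⟩ := s0 (1 - q % 2) (by omega)
  have hlow := e.2
  have r1 := hr.bucket (2 * i + q % 2)
  have r2 := hr.link e
  unfold takeArc
  refine wp_assign (arcTime G W s e) ?_ ?_ ?_
  · simp [hi, hqr, Nat.shiftLeft_eq]; omega
  · simp [hi, hqr, Nat.shiftLeft_eq]; omega
  refine wp_assign (5 + 3 * n + 3 * m + (2 * i + q % 2)) ?_ ?_ ?_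
  · simp [hr.reg5, hi, hqr]
  · simp [hr.reg5, hi, hqr]; omega
  refine wp_assign e ?_ ?_ ?_
  · simp [r1, hbe]
  · simp [r1, hbe]; omega
  refine wp_assign (nxt e) ?_ ?_ ?_
  · simp [hr.reg3, r2]
  · simp [hr.reg3]; omega
  refine wp_store (5 + 3 * n + 3 * m + (2 * i + q % 2)) (nxt e) ?_ ?_ ?_ ?_ ?_
  · simp
  · simp
  · simp
  · simp
  have hr' := ((((hr.assign (i := 10) (by omega) (arcTime G W s e)).assign (i := 20) (by omega)
    (5 + 3 * n + 3 * m + (2 * i + q % 2))).assign (i := 13) (by omega) e).assign (i := 25)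
    (by omega) (nxt e)).storeBucket (2 * i + q % 2) (nxt e)
  refine wp_assign z ?_ ?_ ?_
  · simp [hz]
  · simpa using ite_le (by omega) _
  refine wp_assign (σ.reg 11 ^^^ ((z * (1 - q % 2)) <<< i)) ?_ ?_ ?_
  · simp [hi, hqr]
  · simp [hi, hqr]; omega
  refine wp_assign (σ.reg 12 ^^^ ((z * (q % 2)) <<< i)) ?_ ?_ ?_
  · simp [hi, hqr]
  · simp [hi, hqr]; omega
  have hr'' := ((hr'.assign (i := 26) (by omega) z).assign (i := 11) (by omega)
    (σ.reg 11 ^^^ ((z * (1 - q % 2)) <<< i))).assign (i := 12) (by omega)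
    (σ.reg 12 ^^^ ((z * (q % 2)) <<< i))
  have r3 := hr''.head e
  refine wp_assign (G.head e) ?_ ?_ ?_
  · simp [hr.reg1, Function.update_apply] at r3 ⊢
    exact r3
  · simp [hr.reg1]; omega
  refine ⟨e, he, hmin, ⟨nxt, vis, _, hr''.assign (by omega) _, hv1, hv2, hq', ?_, ?_, ?_⟩, ?_, ?_⟩
  · simpa using hm'
  all_goals simp [h7]

theorem popArc_spec (hB : Sizes G w s S W M X B) (h : Searching G w s S W c V Q y σ)
    (hF : Frontier G W s X V Q y) : Reaches B popArc σ 400 (fun σ' =>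
      (Q = ∅ ∧ σ'.reg 8 = 0 ∧ σ'.reg 11 = 0 ∧ σ'.reg 12 = 0 ∧ Searching G w s S W c V ∅ y σ') ∨
      ∃ e ∈ Q, (∀ f ∈ Q, arcTime G W s e ≤ arcTime G W s f) ∧
      Searching G w s S W c V (Q.erase e) (arcTime G W s e) σ' ∧ σ'.reg 9 = G.head e ∧
      σ'.reg 8 ≠ 0) := by
  obtain ⟨nxt, vis, bh, hr, hv1, hv2, hq, hm, h7, h10⟩ := id h
  have hroom := hB.room
  have hM := hB.one_le
  obtain ⟨b0, b1⟩ := lt_two_pow_of_isMask hq hm (t := Nat.log 2 M + 1)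
    fun f _ => slot_lt G s hM hB.weight_le f
  have ht := two_pow_log_le hM
  have b2 := Nat.or_lt_two_pow b0 b1
  have hone : (assign 8 (bin .or (reg 11) (reg 12))).wp B (fun σ' => σ' =
      ⟨Function.update σ.reg 8 (σ.reg 11 ||| σ.reg 12), σ.mem⟩) σ := by
    refine ⟨?_, ?_⟩
    · simp; omega
    · simp
  refine ((reaches_of_wp hone).seq (T' := 390) ?_).mono (by decide) fun _ => id
  rintro σ' rfl
  obtain ⟨σ', hσ'⟩ : ∃ σ' : State,
      σ' = ⟨Function.update σ.reg 8 (σ.reg 11 ||| σ.reg 12), σ.mem⟩ := ⟨_, rfl⟩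
  have hs : Searching G w s S W c V Q y σ' :=
    ⟨nxt, vis, bh, hσ' ▸ hr.assign (by omega) _, hv1, hv2, hq, by simpa [hσ', h7, h10] using hm⟩
  have e8 : σ'.reg 8 = σ'.reg 11 ||| σ'.reg 12 := by simp [hσ']
  rw [← hσ']
  refine (Reaches.ite (T := selectBucket.cost + takeArc.cost) ?_ ?_ ?_).mono (by decide)
    fun _ => id
  · simp
  · intro hne
    refine (reaches_of_wp (selectBucket_spec hB hs hF (e8 ▸ hne))).seq ?_
    rintro σ₂ ⟨g, g8, gN⟩
    refine (reaches_of_wp (takeArc_spec hB g hF gN)).mono le_rfl ?_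
    rintro σ₃ ⟨e, he, hmin, k, k9, k8⟩
    exact Or.inr ⟨e, he, hmin, k, k9, by rw [k8, g8]; exact hne⟩
  · intro h0
    have h0 : σ'.reg 8 = 0 := h0
    rw [h0] at e8
    have z0 : σ'.reg 11 = 0 := by
      have := @Nat.left_le_or (σ'.reg 11) (σ'.reg 12); omega
    have z1 : σ'.reg 12 = 0 := by
      have := @Nat.right_le_or (σ'.reg 11) (σ'.reg 12); omega
    have hQ : Q = ∅ := by
      refine Finset.eq_empty_of_forall_notMem fun e he => ?_
      obtain ⟨nxt, vis, bh, hr, hv1, hv2, hq, hm, h7, h10⟩ := hs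
      have := (hm _ _).2 (hq.bh_ne_zero he)
      simp [bucketBit, z0, z1] at this
    refine (reaches_of_wp (p := skip) ?_).mono (by decide) fun _ => id
    exact Or.inl ⟨hQ, h0, z0, z1, hQ ▸ hs⟩

/-! ### A round -/

/-- The number of arcs whose tail is not in `V`. -/
def arcsOutside (G : ArcGraph n m) (V : Finset (Fin n)) : ℕ :=
  (Finset.univ.filter fun e => G.tail e ∉ V).card

theorem offset_succ (G : ArcGraph n m) (v : Fin n) : offset G (v + 1) =
    offset G v + (Finset.univ.filter fun e => G.tail e = v).card := by
  unfold offset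
  rw [← Finset.card_union_of_disjoint]
  · congr 1
    ext e
    simp only [Finset.mem_union, Finset.mem_filter, Finset.mem_univ, true_and, Fin.ext_iff]
    omega
  · rw [Finset.disjoint_filter]
    rintro e - h rfl
    omega

theorem arcsOutside_insert (G : ArcGraph n m) {v : Fin n} (hv : v ∉ V) : arcsOutside G V =
    arcsOutside G (insert v V) + (Finset.univ.filter fun e => G.tail e = v).card := by
  unfold arcsOutside
  rw [← Finset.card_union_of_disjoint]
  · congr 1
    ext e
    simp only [Finset.mem_union, Finset.mem_filter, Finset.mem_univ, true_and, Finset.mem_insert]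
    by_cases h : G.tail e = v
    · simp [h, hv]
    · simp [h]
  · rw [Finset.disjoint_filter]
    rintro e - h rfl
    simp at h

theorem visit_spec (hc : 0 < c) (hG : Monotone G.tail) (hB : Sizes G w s S W M X B)
    (hcB : c ≤ B) {v : Fin n}
    (hP : Pending G W s X V Q y v) (h : Searching G w s S W c V Q y σ) (h9 : σ.reg 9 = v) :
    ∃ V' Q', Frontier G W s X V' Q' y ∧ Q'.card + arcsOutside G V' ≤ Q.card + arcsOutside G V ∧
      arcsOutside G V' ≤ arcsOutside G V ∧
      Reaches B (ite (bin .eq (arr 4 (reg 9)) (reg 7)) skip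
        (seq visitVertex (loop (bin .lt (reg 13) (reg 14)) scanArc))) σ
        (100 + 210 * (arcsOutside G V - arcsOutside G V')) (Searching G w s S W c V' Q' y) := by
  obtain ⟨nxt, vis, bh, hr, hv1, hv2, hq, hm, h7, h10⟩ := id h
  have hroom := hB.room
  have hvn := v.2
  have hr1 := hr.visit v
  have hok : Ok B σ (bin .eq (arr 4 (reg 9)) (reg 7)) := by
    simp [hr.reg4, h9]
    exact ⟨by omega, ite_le (by omega) _⟩
  have hval : (bin .eq (arr 4 (reg 9)) (reg 7)).val σ = if vis v = c then 1 else 0 := by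
    simp [hr.reg4, h9, hr1, h7]
  by_cases hv : v ∈ V
  · refine ⟨V, Q, hP.frontier_of_mem hv, le_rfl, le_rfl, (Reaches.ite (T := 10) hok ?_ ?_).mono ?_
      fun _ => id⟩
    · intro _
      exact (reaches_of_wp (show skip.wp B (Searching G w s S W c V Q y) σ from h)).mono
        (by decide) fun _ => id
    · intro h0
      rw [hval, if_pos (hv1 v hv)] at h0
      exact absurd h0 one_ne_zero
    · simp [Expr.cost]
  · have hy := hP.eq_arrival hB.reach hv
    have hcard := arcsOutside_insert G hv
    have hoff := offset_succ G v
    refine ⟨_, _, hP.frontier_insert hy, ?_, by omega,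
      (Reaches.ite (T := 80 + 210 * (offset G (v + 1) - offset G v)) hok ?_ ?_).mono ?_
      fun _ => id⟩
    · have h1 := Finset.card_union_le Q
        (Finset.univ.filter fun e => G.tail e = v ∧ G.head e ∉ insert v V)
      have h2 : (Finset.univ.filter fun e => G.tail e = v ∧ G.head e ∉ insert v V).card ≤
          (Finset.univ.filter fun e => G.tail e = v).card :=
        Finset.card_le_card fun e he => by
          simp only [Finset.mem_filter] at he ⊢
          exact ⟨he.1, he.2.1⟩
      omega
    · intro h0
      rw [hval, if_neg] at h0
      · exact absurd rfl h0
      · have := hv2 v hv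
        omega
    · intro _
      refine ((reaches_of_wp (visitVertex_spec hB h h9 hv hy)).seq
        (T' := 210 * (offset G (v + 1) - offset G v) + 4) ?_).mono ?_ fun _ => id
      · rintro σ' ⟨g, g13, g14, g15⟩
        refine (scanLoop_spec hc hG hB hy _ g (by omega) le_rfl g13 g14 g15 ?_).mono le_rfl
          fun σ₂ hσ₂ => ?_
        · rintro e rfl - he
          exact hv (hP.queue e he).1
        · convert hσ₂ using 3 with e
          constructor
          · rintro ⟨h1, h2⟩
            refine ⟨h1, ?_, h2⟩
            by_contra hlt
            have := (lt_offset_iff hG e v).1 (by omega)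
            rw [h1] at this
            omega
          · rintro ⟨h1, -, h2⟩
            exact ⟨h1, h2⟩
      · have : visitVertex.cost ≤ 70 := by decide
        omega
    · simp only [Expr.cost, arr]
      omega

theorem searchLoop_spec (hc : 0 < c) (hG : Monotone G.tail) (hB : Sizes G w s S W M X B)
    (hcB : c ≤ B) (N : ℕ) : ∀ {V : Finset (Fin n)} {Q : Finset (Fin m)} {y : ℕ} {v : Fin n}
    {σ : State}, Q.card + arcsOutside G V ≤ N → Pending G W s X V Q y v →
    Searching G w s S W c V Q y σ → σ.reg 9 = v → σ.reg 8 ≠ 0 →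
    Reaches B (loop (reg 8) searchStep) σ
      (600 * (N + 1) + 210 * arcsOutside G V + 10) (fun σ' => ∃ y',
      σ'.reg 11 = 0 ∧ σ'.reg 12 = 0 ∧ Searching G w s S W c Finset.univ ∅ y' σ') := by
  induction N with
  | zero =>
    intro V Q y v σ hN hP h h9 h8
    obtain ⟨V', Q', hF, hcard, hout, hvis⟩ := visit_spec hc hG hB hcB hP h h9
    refine (Reaches.loop_true (by simp) (by simpa using h8)
      (hvis.seq fun σ' h' => popArc_spec hB h' hF) (T' := 5) ?_).mono ?_ fun _ => id
    · rintro σ' (⟨hQ, g8, g11, g12, g⟩ | ⟨e, he, -⟩)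
      · subst hQ
        obtain rfl := hF.eq_univ hB.reach
        exact (Reaches.loop_false (by simp) (by simpa using g8) ⟨y, g11, g12, g⟩).mono (by decide)
          fun _ => id
      · have := Finset.card_pos.2 ⟨e, he⟩
        omega
    · simp only [Expr.cost]; omega
  | succ N ih =>
    intro V Q y v σ hN hP h h9 h8
    obtain ⟨V', Q', hF, hcard, hout, hvis⟩ := visit_spec hc hG hB hcB hP h h9
    refine (Reaches.loop_true (by simp) (by simpa using h8)
      (hvis.seq fun σ' h' => popArc_spec hB h' hF)
      (T' := 600 * (N + 1) + 210 * arcsOutside G V' + 10) ?_).mono ?_ fun _ => id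
    · rintro σ' (⟨hQ, g8, g11, g12, g⟩ | ⟨e, he, hmin, g, g9, g8⟩)
      · subst hQ
        obtain rfl := hF.eq_univ hB.reach
        refine (Reaches.loop_false (by simp) (by simpa using g8) ⟨y, g11, g12, g⟩).mono ?_
          fun _ => id
        simp only [Expr.cost]; omega
      · refine ih ?_ (hF.pending hB he hmin) g g9 g8
        have := Finset.card_pos.2 ⟨e, he⟩
        rw [Finset.card_erase_of_mem he]
        omega
    · simp only [Expr.cost]; omega

/-- Between the rounds: `c` rounds are left and `S` are the sums of the outputs so far. -/
def Idle (G : ArcGraph n m) (w : Fin m → ℕ) (s : Fin n) (S : Fin n → ℕ) (c : ℕ) (σ : State) :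
    Prop :=
  ∃ nxt vis bh, Rep G w s nxt vis S bh σ ∧ (∀ u, vis u = 0 ∨ c < vis u) ∧ (∀ i, bh i = 0) ∧
    σ.reg 11 = 0 ∧ σ.reg 12 = 0 ∧ σ.reg 7 = c

theorem round_spec (hG : Monotone G.tail) (hB : Sizes G w s S W M X B) (hcB : c + 1 ≤ B)
    (h : Idle G w s S (c + 1) σ) :
    Reaches B (seq searchRound (block [assign 7 (bin .sub (reg 7) (lit 1))])) σ (810 * m + 660)
      (Idle G w s (fun v => S v + G.arrival W s v) c) := by
  obtain ⟨nxt, vis, bh, hr, hv, hbh, h11, h12, h7⟩ := h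
  have hroom := hB.room
  refine ((Reaches.seq (T := 20) (T' := 810 * m + 610) (Φ := fun σ' => ∃ y,
    Searching G w s S W (c + 1) ∅ ∅ y σ' ∧ Pending G W s X ∅ ∅ y s ∧ σ'.reg 9 = s ∧ σ'.reg 8 ≠ 0)
    (Ψ := fun σ' => ∃ y',
      σ'.reg 11 = 0 ∧ σ'.reg 12 = 0 ∧ Searching G w s S W (c + 1) Finset.univ ∅ y' σ')
    ((reaches_of_wp ?_).mono (by decide) fun _ => id) ?_).seq (T' := 10) ?_).mono (by omega)
    fun _ => id
  · refine wp_assign s (by simp [hr.reg6]) (by simp) ?_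
    refine wp_assign 0 (by simp) (by simp) ?_
    refine wp_assign 1 (by simp) (by simp; omega) ?_
    refine ⟨0, ⟨nxt, vis, bh, ?_, by simp, fun u _ => hv u, isQueue_empty _ _ hbh, ?_, ?_, ?_⟩,
      ⟨by simp, by simp, by simp, Or.inr ⟨rfl, rfl⟩, (G.arrival_self W s).le, by omega⟩, ?_, ?_⟩
    · simpa using ((hr.assign (i := 9) (by omega) s).assign (i := 10) (by omega) 0).assign
        (i := 8) (by omega) 1
    · simpa [h11, h12] using IsMask.zero hbh
    all_goals simp [h7]
  · rintro σ' ⟨y, g, hP, g9, g8⟩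
    have hout : arcsOutside G ∅ = m := by simp [arcsOutside]
    refine (searchLoop_spec (by omega) hG hB hcB m ?_ hP g g9 g8).mono ?_ fun _ => id
    · simp [hout]
    · omega
  · rintro σ' ⟨y, g11, g12, nxt, vis, bh, hr, hv1, hv2, hq, hm, h7, h10⟩
    refine (reaches_of_wp ?_).mono (by decide) fun _ => id
    refine wp_assign c ?_ ?_ ⟨nxt, vis, bh, ?_, ?_, hq.eq_zero, ?_, ?_, ?_⟩
    · simp [h7]
    · simp [h7]; omega
    · simpa using hr.assign (i := 7) (by omega) c
    · intro u
      have := hv1 u (Finset.mem_univ u)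
      omega
    all_goals simp [g11, g12]

theorem rounds_spec (hG : Monotone G.tail) {R : ℕ} (hR : R ≤ B)
    (hB : ∀ i < R, Sizes G w s (G.roundSum w s i) (G.roundWeight w s i) M X B) (k : ℕ) :
    ∀ {i : ℕ} {σ : State}, i + k = R → Idle G w s (G.roundSum w s i) k σ →
    Reaches B (loop (reg 7) (seq searchRound (block [assign 7 (bin .sub (reg 7) (lit 1))]))) σ
      ((810 * m + 670) * k + 10) (Idle G w s (G.roundSum w s R) 0) := by
  induction k with
  | zero =>
    intro i σ hi h
    obtain rfl : i = R := by omega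
    obtain ⟨nxt, vis, bh, hr, hv, hbh, h11, h12, h7⟩ := id h
    exact (Reaches.loop_false (by simp) (by simpa using h7) h).mono
      (by simp only [Expr.cost]; omega) fun _ => id
  | succ k ih =>
    intro i σ hi h
    obtain ⟨nxt, vis, bh, hr, hv, hbh, h11, h12, h7⟩ := id h
    refine (Reaches.loop_true (by simp) (by simp [h7])
      (round_spec hG (hB i (by omega)) (by omega) h) (T' := (810 * m + 670) * k + 10) ?_).mono ?_
      fun _ => id
    · intro σ' h'
      refine ih (i := i + 1) (by omega) ?_
      convert h' using 1
      funext v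
      exact G.roundSum_succ w s i v
    · simp only [Expr.cost]
      rw [Nat.mul_succ]
      omega

/-! ### The start -/

theorem start_mem (G : ArcGraph n m) (w : Fin m → ℕ) (s : Fin n) (b : ℕ) :
    (start (encode G w s b)).mem 0 = n ∧ (start (encode G w s b)).mem 1 = m ∧
    (start (encode G w s b)).mem 2 = s ∧ (start (encode G w s b)).mem 3 = b ∧
    (∀ v ≤ n, (start (encode G w s b)).mem (v + 4) = offset G v) ∧
    (∀ e : Fin m, (start (encode G w s b)).mem (5 + n + e) = G.head e) ∧
    (∀ e : Fin m, (start (encode G w s b)).mem (5 + n + m + e) = w e) ∧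
    ∀ a, (start (encode G w s b)).mem (5 + n + 2 * m + a) = 0 := by
  refine ⟨by simp [start, encode], by simp [start, encode], by simp [start, encode],
    by simp [start, encode], fun v hv => ?_, fun e => ?_, fun e => ?_, fun a => ?_⟩
  · have h1 : v < n + 1 := by omega
    simp [start, encode, List.getElem?_append, offset, h1]
  · have h1 : 5 + n + (e : ℕ) = (n + 1 + e) + 4 := by omega
    have h2 := e.2
    have h3 : ¬ n + 1 + (e : ℕ) ≤ n := by omega
    rw [h1]
    simp [start, encode, List.getElem?_append, h2, h3]
  · have h1 : 5 + n + m + (e : ℕ) = (n + 1 + m + e) + 4 := by omega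
    have h2 := e.2
    have h3 : ¬ n + 1 + m + (e : ℕ) ≤ n := by omega
    have h4 : n + 1 + m + (e : ℕ) - (n + 1) = m + e := by omega
    rw [h1]
    simp [start, encode, List.getElem?_append, h2, h3, h4]
  · have h1 : 5 + n + 2 * m + a = (n + 1 + m + (m + a)) + 4 := by omega
    have h3 : ¬ n + 1 + m + (m + a) ≤ n := by omega
    have h4 : n + 1 + m + (m + a) - (n + 1) = m + (m + a) := by omega
    rw [h1]
    simp [start, encode, List.getElem?_append, h3, h4]

theorem start_bounded (G : ArcGraph n m) {w : Fin m → ℕ} (s : Fin n) {b : ℕ} (hn : n ≤ B)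
    (hm : m ≤ B) (hb : b ≤ B) (hw : ∀ e, w e ≤ B) : (start (encode G w s b)).Bounded B := by
  obtain ⟨h0, h1, h2, h3, h4, h5, h6, h7⟩ := start_mem G w s b
  refine ⟨fun i => Nat.zero_le _, fun a => ?_⟩
  have hs := s.2
  rcases lt_or_ge a 4 with ha | ha
  · interval_cases a <;> omega
  rcases lt_or_ge a (5 + n) with ha1 | ha1
  · obtain ⟨v, rfl⟩ := Nat.exists_eq_add_of_le' ha
    rw [h4 v (by omega)]
    exact (offset_le G v).trans hm
  rcases lt_or_ge a (5 + n + m) with ha2 | ha2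
  · obtain ⟨e, rfl⟩ := Nat.exists_eq_add_of_le ha1
    rw [h5 ⟨e, by omega⟩]
    exact (G.head _).2.le.trans hn
  rcases lt_or_ge a (5 + n + 2 * m) with ha3 | ha3
  · obtain ⟨e, rfl⟩ := Nat.exists_eq_add_of_le ha2
    rw [h6 ⟨e, by omega⟩]
    exact hw _
  · obtain ⟨e, rfl⟩ := Nat.exists_eq_add_of_le ha3
    rw [h7]
    exact Nat.zero_le _

theorem layoutInit_spec {b R : ℕ} {rounds : Expr} (hroom : 10 + 3 * n + 3 * m ≤ B)
    (hval : ∀ σ, σ.mem = (start (encode G w s b)).mem → rounds.val σ = R)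
    (hok : ∀ σ, σ.mem = (start (encode G w s b)).mem → rounds.Ok B σ) :
    (layoutInit rounds).wp B (Idle G w s (G.roundSum w s 0) R) (start (encode G w s b)) := by
  obtain ⟨h0, h1, h2, h3, h4, h5, h6, h7⟩ := start_mem G w s b
  unfold layoutInit
  refine wp_assign (5 + n) (by simp [h0, add_comm]) (by simp [h0]; omega) ?_
  refine wp_assign (5 + n + m) (by simp [h1]) (by simp [h1]; omega) ?_
  refine wp_assign (5 + n + 2 * m) (by simp [h1]; omega) (by simp [h1]; omega) ?_
  refine wp_assign (5 + n + 3 * m) (by simp [h1]; omega) (by simp [h1]; omega) ?_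
  refine wp_assign (5 + 2 * n + 3 * m) (by simp [h0]; omega) (by simp [h0]; omega) ?_
  refine wp_assign (5 + 3 * n + 3 * m) (by simp [h0]; omega) (by simp [h0]; omega) ?_
  refine wp_assign s (by simp [h2]) (by simp; omega) ?_
  refine wp_assign R (hval _ rfl) (hok _ rfl) ?_
  refine ⟨fun _ => 0, fun _ => 0, fun _ => 0, ⟨by simp, by simp, by simp, by simp, by simp, by simp,
    by simp, h4, h5, h6, fun e => h7 e, fun v => ?_, fun v => ?_, fun i => ?_⟩, by simp, by simp, ?_⟩
  · rw [← h7 (m + v)]; exact congrArg _ (by omega)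
  · have : G.roundSum w s 0 v = 0 := rfl
    rw [this, ← h7 (n + m + v)]; exact congrArg _ (by omega)
  · rw [← h7 (2 * n + m + i)]; exact congrArg _ (by omega)
  · simp [start]

theorem computes_sumOfRounds (hG : Monotone G.tail) {b R : ℕ} {rounds : Expr} (hR : R ≤ B)
    (hb : b ≤ B) (hw : ∀ e, w e ≤ B) (hroom : 10 + 3 * n + 3 * m ≤ B)
    (hB : ∀ i < R, Sizes G w s (G.roundSum w s i) (G.roundWeight w s i) M X B)
    (hval : ∀ σ, σ.mem = (start (encode G w s b)).mem → rounds.val σ = R)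
    (hok : ∀ σ, σ.mem = (start (encode G w s b)).mem → rounds.Ok B σ) {T : ℝ}
    (hT : (((810 * m + 670) * R + 10 + (layoutInit rounds).cost : ℕ) : ℝ) ≤ T) :
    Computes (sumOfRounds rounds) B T (encode G w s b) (G.roundSum w s R) := by
  obtain ⟨t, σ, h1, h2, -, nxt, vis, bh, hr, -⟩ :=
    ((reaches_of_wp (layoutInit_spec hroom hval hok)).seq fun σ' h' =>
      rounds_spec hG hR hB R (Nat.zero_add R) h')
      (start_bounded G s (by omega) (by omega) hb hw)
  refine ⟨t, σ, h1, le_trans (by exact_mod_cast (by omega)) hT, fun v => ?_⟩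
  rw [hr.reg0]
  exact hr.total v

end RAM

namespace RAM

open RAM.Expr

/-- All rounds together on numbers of at most `(n + m + b) ^ (k + 10)`. -/
theorem computes_rounds {k n m b R : ℕ} {G : ArcGraph n m} {w : Fin m → ℕ} {s : Fin n}
    (hm : 0 < m) (hG : Monotone G.tail) (hs : G.AllReachable s) {rounds : Expr}
    (hR : R ≤ 3 * b + 1) (hR0 : 0 < R)
    (hW : ∀ i < R, ∀ e, G.roundWeight w s i e ≤ n ^ (k + 1))
    (hS : ∀ i < R, ∀ v, G.roundSum w s i v ≤ n * n ^ (k + 1))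
    (hval : ∀ σ, σ.mem = (start (encode G w s b)).mem → rounds.val σ = R)
    (hok : ∀ B, 3 * b + 10 ≤ B → ∀ σ, σ.mem = (start (encode G w s b)).mem → rounds.Ok B σ)
    (hcost : rounds.cost ≤ 10) :
    Computes (sumOfRounds rounds) ((n + m + b) ^ (k + 10)) (2000 * m * R)
      (encode G w s b) (G.roundSum w s R) := by
  have hn : 0 < n := by have := s.2; omega
  have hN : 2 ≤ n + m + b := by omega
  have h1 : 1 ≤ n ^ (k + 1) := Nat.one_le_pow _ _ hn
  have h2 : n ^ (k + 1) ≤ n * n ^ (k + 1) := Nat.le_mul_of_pos_left _ hn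
  have h3 : n * n ^ (k + 1) ≤ (n + m + b) ^ (k + 2) := by
    rw [← pow_succ']
    exact Nat.pow_le_pow_left (by omega) _
  have h4 : n + m + b ≤ (n + m + b) ^ (k + 2) := Nat.le_self_pow (by omega) _
  have h5 : 256 * (n + m + b) ^ (k + 2) ≤ (n + m + b) ^ (k + 10) := by
    have : 2 ^ 8 ≤ (n + m + b) ^ 8 := Nat.pow_le_pow_left hN 8
    calc 256 * (n + m + b) ^ (k + 2) ≤ (n + m + b) ^ 8 * (n + m + b) ^ (k + 2) :=
          Nat.mul_le_mul_right _ (by omega)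
      _ = _ := by rw [← pow_add]; congr 1; omega
  refine computes_sumOfRounds (w := w) hG (M := n ^ (k + 1)) (X := n * n ^ (k + 1)) (by omega) (by omega)
    (fun e => (hW 0 hR0 e).trans (by omega)) (by omega) (fun i hi => ?_) hval
    (hok _ (by omega)) ?_
  · refine ⟨hs, h1, hW i hi, hS i hi, fun v => ?_, G.roundWeight_add w hs i, by omega⟩
    have h6 := ArcGraph.arrival_bound hs (hW i hi) v
    have h7 : n * n ^ (k + 1) = (n - 1) * n ^ (k + 1) + n ^ (k + 1) := by
      obtain ⟨l, rfl⟩ : ∃ l, n = l + 1 := ⟨n - 1, by omega⟩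
      simp only [Nat.add_sub_cancel]
      ring
    omega
  · have h8 : (layoutInit rounds).cost ≤ 100 := by
      simp only [layoutInit, Prog.block, Prog.cost, Expr.cost]
      omega
    have h9 : 1 ≤ m * R := Nat.mul_pos hm hR0
    have h10 : R ≤ m * R := Nat.le_mul_of_pos_left R hm
    have h11 : (810 * m + 670) * R + 10 + (layoutInit rounds).cost ≤ 2000 * m * R := by
      have : (810 * m + 670) * R = 810 * (m * R) + 670 * R := by ring
      have : 2000 * m * R = 2000 * (m * R) := by ring
      omega
    exact_mod_cast h11

end RAM

theorem ceil_logb_bounds {ε : ℝ} (h0 : 0 < ε) (h1 : ε < 1) :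
    0 < ⌈Real.logb 2 (1 / ε)⌉₊ ∧
    ((3 * ⌈Real.logb 2 (1 / ε)⌉₊ : ℕ) : ℝ) ≤ 6 * (1 + Real.log (1 / ε)) ∧
    1 - ε ≤ 1 - (1 - 1 / 4 : ℝ) ^ (3 * ⌈Real.logb 2 (1 / ε)⌉₊) := by
  have hε : 1 < 1 / ε := by rw [lt_div_iff₀ h0]; linarith
  have hlog : 0 < Real.log (1 / ε) := Real.log_pos hε
  have hlogb : 0 < Real.logb 2 (1 / ε) := Real.logb_pos (by norm_num) hε
  refine ⟨Nat.ceil_pos.2 hlogb, ?_, ?_⟩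
  · have h2 := (Nat.ceil_lt_add_one hlogb.le).le
    have h3 : Real.logb 2 (1 / ε) ≤ 2 * Real.log (1 / ε) := by
      have := Real.log_two_gt_d9
      rw [Real.logb, div_le_iff₀ (by linarith)]
      nlinarith
    push_cast
    linarith
  · have h2 := Nat.le_ceil (Real.logb 2 (1 / ε))
    have h3 : 1 / ε ≤ 2 ^ ⌈Real.logb 2 (1 / ε)⌉₊ := by
      rw [← Real.rpow_natCast, ← Real.logb_le_iff_le_rpow (by norm_num) (by positivity)]
      exact h2
    have h4 : (1 - 1 / 4 : ℝ) ^ (3 * ⌈Real.logb 2 (1 / ε)⌉₊) ≤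
        (1 / 2) ^ ⌈Real.logb 2 (1 / ε)⌉₊ := by
      rw [pow_mul]
      exact pow_le_pow_left₀ (by norm_num) (by norm_num) _
    rw [one_div_pow] at h4
    have h5 := one_div_le_one_div_of_le (by positivity) h3
    rw [one_div_one_div] at h5
    linarith

theorem mainTheorem5 :
    ∃ (K : ℝ) (R : ℝ → ℕ),
      -- the number of rounds is `O(log (1/ε))`
      (∀ ε : ℝ, 0 < ε → ε < 1 → (R ε : ℝ) ≤ K * (1 + Real.log (1 / ε))) ∧
      -- repeated use, with reweighting, of any `1/4`-distance-preserving algorithm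
      (∀ ε : ℝ, 0 < ε → ε < 1 →
        ∀ (n m : ℕ) (G : ArcGraph n m) (w : Fin m → ℝ) (s : Fin n) (d : ℕ → Fin n → ℝ),
          (∀ e, 0 ≤ w e) → G.AllReachable s →
          (∀ i < R ε, G.DistPreserving (G.reweight w d i) s (1 / 4) (d i)) →
          (∀ i ≤ R ε, ∀ e, 0 ≤ G.reweight w d i e) ∧
          G.DistPreserving w s (1 - ε) (fun v => ∑ i ∈ Finset.range (R ε), d i v)) ∧
      -- the running time for weights in the range `n ^ O(1)`
      ∀ k : ℕ, ∃ (A : ∀ n m : ℕ, ArcGraph n m → (Fin m → ℕ) → Fin n → Fin n → ℕ)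
          (P Q : RAM.Prog) (c : ℕ) (C : ℝ),
        -- `P` computes `1/4`-distance-preserving distances `A` in time `O(m)`
        (∀ (n m : ℕ) (G : ArcGraph n m) (w : Fin m → ℕ) (s : Fin n),
          0 < m → Monotone G.tail → G.AllReachable s → (∀ e, w e ≤ n ^ (k + 1)) →
          G.DistPreserving (fun e => (w e : ℝ)) s (1 / 4) (fun v => (A n m G w s v : ℝ)) ∧
          RAM.Computes P ((n + m) ^ c) (C * m) (RAM.encode G w s 0) (A n m G w s)) ∧
        -- `Q` computes the sum of the outputs of the `R ε` rounds in time `O(m log (1/ε))`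
        (∀ ε : ℝ, 0 < ε → ε < 1 →
          ∀ (n m : ℕ) (G : ArcGraph n m) (w : Fin m → ℕ) (s : Fin n),
            0 < m → Monotone G.tail → G.AllReachable s → (∀ e, w e ≤ n ^ k) →
            ∃ W : ℕ → Fin m → ℕ,
              (∀ i ≤ R ε, ∀ e, W i e ≤ n ^ (k + 1) ∧
                (W i e : ℝ) =
                  G.reweight (fun e => (w e : ℝ)) (fun j v => (A n m G (W j) s v : ℝ)) i e) ∧
              (∀ δ : ℝ, 0 < δ →
                G.DistPreserving (fun e => δ * (w e : ℝ)) s (1 - ε)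
                  (fun v => δ * ∑ i ∈ Finset.range (R ε), (A n m G (W i) s v : ℝ))) ∧
              RAM.Computes Q ((n + m + ⌈Real.logb 2 (1 / ε)⌉₊) ^ c)
                (C * m * (1 + Real.log (1 / ε)))
                (RAM.encode G w s ⌈Real.logb 2 (1 / ε)⌉₊)
                (fun v => ∑ i ∈ Finset.range (R ε), A n m G (W i) s v)) := by
  refine ⟨6, fun ε => 3 * ⌈Real.logb 2 (1 / ε)⌉₊, fun ε h0 h1 => (ceil_logb_bounds h0 h1).2.1,
    ?_, fun k => ⟨fun n m G w s => G.arrival w s, RAM.sumOfRounds (.lit 1),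
    RAM.sumOfRounds (.bin .mul (.lit 3) (.load (.lit 3))), k + 10, 12000, ?_, ?_⟩⟩
  · intro ε h0 h1 n m G w s d hw hs hd
    exact ⟨ArcGraph.reweight_nonneg hw hd, ArcGraph.distPreserving_sum (by norm_num) (by norm_num)
      hw hs hd (by linarith) (ceil_logb_bounds h0 h1).2.2⟩
  · intro n m G w s hm hG hs hw
    refine ⟨by simpa using ArcGraph.distPreserving_arrival w hs zero_le_one, ?_⟩
    have h := RAM.computes_rounds (k := k) (b := 0) (R := 1) (w := w) (rounds := .lit 1) hm hG hs
      (by omega) (by omega)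
      (fun i hi => by obtain rfl : i = 0 := by omega
                      exact hw)
      (fun i hi v => by obtain rfl : i = 0 := by omega
                        exact Nat.zero_le _)
      (fun σ _ => rfl) (fun B hB σ _ => by simp; omega) (by decide)
    obtain ⟨t, σ, h1, h2, h3⟩ := h
    refine ⟨t, σ, h1, h2.trans ?_, fun v => (h3 v).trans ?_⟩
    · have : (0 : ℝ) ≤ m := Nat.cast_nonneg m
      push_cast
      linarith
    · simp [ArcGraph.roundSum, ArcGraph.roundWeight]
  · intro ε h0 h1 n m G w s hm hG hs hw
    obtain ⟨hb, hK, hε⟩ := ceil_logb_bounds h0 h1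
    have hW : ∀ i e, G.roundWeight w s i e ≤ n ^ (k + 1) := fun i e => by
      rw [pow_succ']
      exact ArcGraph.roundWeight_le hs hw i e
    refine ⟨G.roundWeight w s, fun i _ e => ⟨hW i e, ?_⟩, fun δ hδ => ?_, ?_⟩
    · simpa using (ArcGraph.cast_roundWeight w hs 1 i e).symm
    · have := ArcGraph.distPreserving_sum (G := G) (s := s) (w := fun e => δ * (w e : ℝ))
        (d := fun j v => δ * (G.arrival (G.roundWeight w s j) s v : ℝ)) (α := 1 / 4)
        (R := 3 * ⌈Real.logb 2 (1 / ε)⌉₊) (β := 1 - ε) (by norm_num) (by norm_num)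
        (fun e => by positivity) hs (fun i _ => ?_) (by linarith) hε
      · simpa only [Finset.mul_sum] using this
      · have h2 := ArcGraph.distPreserving_arrival (G.roundWeight w s i) hs hδ.le
        convert h2 using 1
        funext e
        exact ArcGraph.cast_roundWeight w hs δ i e
    · obtain ⟨t, σ, h2, h3, h4⟩ := RAM.computes_rounds (k := k) (b := ⌈Real.logb 2 (1 / ε)⌉₊)
        (R := 3 * ⌈Real.logb 2 (1 / ε)⌉₊) (w := w)
        (rounds := .bin .mul (.lit 3) (.load (.lit 3))) hm hG hs
        (by omega) (by omega) (fun i _ => hW i)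
        (fun i _ v => (ArcGraph.roundSum_le hs hw i v).trans
          (Nat.mul_le_mul (Nat.sub_le _ _) (Nat.pow_le_pow_right (by have := s.2; omega)
            (Nat.le_succ k))))
        (fun σ hσ => by simp [hσ, (RAM.start_mem G w s _).2.2.2.1])
        (fun B hB σ hσ => by
          simp only [RAM.Expr.Ok, RAM.Expr.val, RAM.BinOp.eval, hσ,
            (RAM.start_mem G w s _).2.2.2.1]
          omega) (by decide)
      refine ⟨t, σ, h2, h3.trans ?_, h4⟩
      calc (2000 : ℝ) * m * ((3 * ⌈Real.logb 2 (1 / ε)⌉₊ : ℕ) : ℝ)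
          ≤ 2000 * m * (6 * (1 + Real.log (1 / ε))) :=
            mul_le_mul_of_nonneg_left hK (by positivity)
        _ = 12000 * m * (1 + Real.log (1 / ε)) := by ring
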